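/- Let $p,k\ge 0$ be integers with $2k<p$. Put $$\mathcal F_1(k)=\{\Sigma=(\sigma_{ij})\in\mathbb R^{p\times p}:\Sigma\succeq 0,\ \sigma_{ij}=0\text{ if }|i-j|>k\},$$ and let $\mathcal F_2(k)$ be the set of all $\Sigma\in\mathbb R^{p\times p}$, $\Sigma\succeq 0$, for which there is a set of indices $I$ with $|I|\le k$ such that $\Sigma-\mathrm{diag}(\Sigma)$ vanishes outside $I\times I$. For $0<M_1<M_2$ let $\Theta_i(k)=\{\Sigma\in\mathcal F_i(k): M_1\le\|\Sigma\|_2\le M_2\}$, where $\|\cdot\|_2$ is the spectral norm. Let $W$ be the Wasserstein-1 distance on $\mathbb R^p$ for the Euclidean norm, and $P_\Sigma=\mathcal N(0,\Sigma)$. For a set $\Theta$ of positive semidefinite matrices, $n\ge1$, $\epsilon\ge0$ and $r\ge 0$ put $$\mathcal R_n(\Theta,\epsilon,r)=\inf_{\widehat\Sigma}\ \sup_{\Sigma^*\in\Theta,\ P:\,W(P_{\Sigma^*},P)\le\epsilon}\ \mathbb P\left(\|\Sigma^*-\widehat\Sigma\|_2\ge r\right),$$ where $P$ ranges over the probability distributions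 on $\mathbb R^p$, the infimum is over all (measurable) estimators $\widehat\Sigma=\widehat\Sigma(X_1,\dots,X_n)\in\mathbb R^{p\times p}$, and $X_1,\dots,X_n$ are i.i.d. from $P$. 1. (Banded matrices.) For all $0<M_1<M_2$ and $A>0$ there are constants $C_1,c_1>0$, depending only on $M_1,M_2,A$, such that for all $n\ge1$, $k\ge 0$, $p>2k$ and $\epsilon\in[0,1]$ with $\frac{k+\log p}{n}\le A$, $$\mathcal R_n\left(\Theta_1(k),\epsilon,\ C_1\left(\sqrt{\tfrac{k+\log p}{n}}\vee\epsilon\right)\right)\ge c_1.$$ Moreover, there are absolute constants $C_1,c_1>0$ such that the same inequality holds with $\mathcal F_1(k)$ in place of $\Theta_1(k)$, for all $n\ge1$, $k\ge0$, $p>2k$ and $\epsilon\ge0$. 2. (Sparse matrices.) For all $0<M_1<M_2$ and $A>0$ there are constants $C_2,c_2>0$, depending only on $M_1,M_2,A$, such that for all $n\ge1$, $k\ge 1$, $p>2k$ and $\epsilon\in[0,1]$ with $\frac{k+k\log(p/k)}{n}\le A$, $$\mathcal R_n\left(\Theta_2(k),\epsilon,\ C_2\left(\sqrt{\tfrac{k+k\log\frac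 pk}{n}}\vee\epsilon\right)\right)\ge c_2.$$ Moreover, there are absolute constants $C_2,c_2>0$ such that the same inequality holds with $\mathcal F_2(k)$ in place of $\Theta_2(k)$, for all $n\ge1$, $k\ge1$, $p>2k$ and $\epsilon\ge0$. -/

import Mathlib

open MeasureTheory ProbabilityTheory
open scoped ENNReal

noncomputable section

/-- The Wasserstein distance of order one between two measures on a Euclidean space:
the infimum over all couplings of the expected Euclidean distance (an extended real). -/
def wassersteinOne {p : ℕ} (P Q : Measure (EuclideanSpace ℝ (Fin p))) : ℝ≥0∞ :=
  ⨅ (π : Measure (EuclideanSpace ℝ (Fin p) × EuclideanSpace ℝ (Fin p)))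
    (_ : π.map Prod.fst = P) (_ : π.map Prod.snd = Q), ∫⁻ z, edist z.1 z.2 ∂π

/-- The spectral norm of a square real matrix: its operator norm on Euclidean space. -/
def spectralNorm₂ {p : ℕ} (A : Matrix (Fin p) (Fin p) ℝ) : ℝ :=
  ‖Matrix.toEuclideanCLM (n := Fin p) (𝕜 := ℝ) A‖

/-- Positive semidefinite matrices of bandwidth `k`. -/
def bandedCov (p k : ℕ) : Set (Matrix (Fin p) (Fin p) ℝ) :=
  {S | S.PosSemidef ∧ ∀ i j : Fin p, (k : ℤ) < |(i : ℤ) - (j : ℤ)| → S i j = 0}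

/-- Matrices that vanish outside `I × I` for some set of indices `I` with at most `k` elements. -/
def blockSupported (p k : ℕ) : Set (Matrix (Fin p) (Fin p) ℝ) :=
  {G | ∃ I : Finset (Fin p), I.card ≤ k ∧ ∀ i j : Fin p, i ∉ I ∨ j ∉ I → G i j = 0}

/-- Positive semidefinite matrices whose off-diagonal part is supported on a `k × k` block. -/
def sparseCov (p k : ℕ) : Set (Matrix (Fin p) (Fin p) ℝ) :=
  {S | S.PosSemidef ∧ S - Matrix.diagonal S.diag ∈ blockSupported p k}

/-- The matrices of a class whose spectral norm lies between `M₁` and `M₂`. -/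
def normBounded {p : ℕ} (F : Set (Matrix (Fin p) (Fin p) ℝ)) (M₁ M₂ : ℝ) :
    Set (Matrix (Fin p) (Fin p) ℝ) :=
  {S | S ∈ F ∧ M₁ ≤ spectralNorm₂ S ∧ spectralNorm₂ S ≤ M₂}

/-- An estimator: a measurable map from samples of size `n` to matrices. -/
def IsEstimator {n p : ℕ}
    (T : (Fin n → EuclideanSpace ℝ (Fin p)) → Matrix (Fin p) (Fin p) ℝ) : Prop :=
  ∀ i j : Fin p, Measurable fun x => T x i j

/-- The infimum over all estimators `T` of the supremum, over all true covariance matrices `S` in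
`Θ` and all distributions `P` within Wasserstein distance `ε` of `N(0, S)`, of the probability,
under `n` independent observations from `P`, that the spectral error of `T` is at least `r`. -/
def minimaxErrorProb {p : ℕ} (n : ℕ) (Θ : Set (Matrix (Fin p) (Fin p) ℝ)) (ε r : ℝ) : ℝ≥0∞ :=
  ⨅ (T : (Fin n → EuclideanSpace ℝ (Fin p)) → Matrix (Fin p) (Fin p) ℝ) (_ : IsEstimator T),
    ⨆ (S : Matrix (Fin p) (Fin p) ℝ) (_ : S ∈ Θ)
      (P : ProbabilityMeasure (EuclideanSpace ℝ (Fin p)))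
      (_ : wassersteinOne (multivariateGaussian 0 S) (P : Measure _) ≤ ENNReal.ofReal ε),
      Measure.pi (fun _ : Fin n => (P : Measure (EuclideanSpace ℝ (Fin p))))
        {x | r ≤ spectralNorm₂ (S - T x)}

end

/-! The rate is a maximum of two terms; each is bounded separately and the larger one is used.

Contamination. On the line spanned by a unit vector u, the laws of b w u and c w u with w ~ N(0,1)
can be coupled through the same w, so their Wasserstein distance is at most |b - c|
(`wassersteinOne_line_le`), while their covariances differ by |b² - c²|. Data meant to come from one
law may have exactly the other, so no estimator serves both covariances
(`minimaxErrorProb_ge_of_wassersteinOne_le`).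

Sampling. The identity is tested against the uniform mixture of 1 + τ e eᵀ, where e has one entry ±1
in each of d groups of m coordinates. The second moment of the averaged likelihood ratio is at most
the mean of exp(n τ² ⟨e, e'⟩²). The overlap ⟨e, e'⟩ is a sum of d independent terms, each nonzero
with probability 1/m, hence sub-Gaussian with variance proxy of order d / log m. So the second
moment is at most 2 once n τ² d ≤ log m / 16 (`sum_exp_sq_inner_signVector_le`), and mixture and
null cannot be told apart (`sum_withDensity_le`, `minimaxErrorProb_ge_of_spikedCov`). The spectral
separation τ d can thus be of order sqrt(d log m / n). Banded matrices use (d, m) = (1, p) or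
(⌈k/2⌉, 2), whichever of log p and k dominates; sparse ones use (k, ⌊p/k⌋).

Without norm bounds, an indistinguishable family with fixed τ is multiplied by a large scalar, so
every error level r is exceeded with constant probability. -/

noncomputable section

/-! ### Gaussian likelihood ratios and their second moments -/

section Densities

/-- A finite product of measures with densities has the product density. -/
lemma pi_withDensity_eq {ι : Type*} [Fintype ι] {α : ι → Type*} [∀ i, MeasurableSpace (α i)]
    (μ : ∀ i, Measure (α i)) [∀ i, IsProbabilityMeasure (μ i)] (f : ∀ i, α i → ℝ≥0∞)
    (hf : ∀ i, Measurable (f i)) [∀ i, SigmaFinite ((μ i).withDensity (f i))] :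
    Measure.pi (fun i => (μ i).withDensity (f i)) =
      (Measure.pi μ).withDensity (fun x => ∏ i, f i (x i)) := by
  refine Measure.pi_eq fun s hs => ?_
  rw [withDensity_apply _ (MeasurableSet.univ_pi hs), ← lintegral_indicator (MeasurableSet.univ_pi hs)]
  have h1 : (Set.univ.pi s).indicator (fun x : ∀ i, α i => ∏ i, f i (x i)) =
      fun x => ∏ i, (s i).indicator (f i) (x i) := by
    classical
    ext x
    by_cases hx : x ∈ Set.univ.pi s
    · rw [Set.indicator_of_mem hx]
      exact Finset.prod_congr rfl fun i _ => (Set.indicator_of_mem (hx i trivial) _).symm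
    · rw [Set.indicator_of_notMem hx]
      simp only [Set.mem_pi, Set.mem_univ, true_imp_iff, not_forall] at hx
      obtain ⟨i, hi⟩ := hx
      exact (Finset.prod_eq_zero (Finset.mem_univ i) (Set.indicator_of_notMem hi _)).symm
  have hm : ∀ i, Measurable ((s i).indicator (f i)) := fun i => (hf i).indicator (hs i)
  rw [h1, lintegral_prod_eq_prod_lintegral_of_indepFun Finset.univ
    (fun i (x : ∀ i, α i) => (s i).indicator (f i) (x i))
    (iIndepFun_pi (X := fun i => (s i).indicator (f i)) fun i => (hm i).aemeasurable)
    (fun i => (hm i).comp (measurable_pi_apply i))]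
  refine Finset.prod_congr rfl fun i _ => ?_
  rw [withDensity_apply _ (hs i), ← lintegral_indicator (hs i)]
  exact (measurePreserving_eval μ i).lintegral_comp (hm i)

lemma gaussianReal_shift_density (m : ℝ) :
    gaussianReal m 1 =
      (gaussianReal 0 1).withDensity (fun x => ENNReal.ofReal (Real.exp (m * x - m ^ 2 / 2))) := by
  rw [gaussianReal_of_var_ne_zero _ one_ne_zero, gaussianReal_of_var_ne_zero _ one_ne_zero,
    ← withDensity_mul _ (measurable_gaussianPDF _ _) (by fun_prop)]
  congr 1
  ext x
  simp only [Pi.mul_apply, gaussianPDF]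
  rw [← ENNReal.ofReal_mul (gaussianPDFReal_nonneg _ _ _), gaussianPDFReal_def,
    gaussianPDFReal_def]
  congr 1
  simp only []
  rw [mul_assoc (Real.sqrt _)⁻¹, ← Real.exp_add]
  congr 2
  simp
  ring

variable {p : ℕ}

local notation "𝔼" => EuclideanSpace ℝ (Fin p)

/-- The density of a translate of the standard Gaussian measure. -/
lemma stdGaussian_map_add_eq (u : 𝔼) :
    (stdGaussian 𝔼).map (fun x => x + u) = (stdGaussian 𝔼).withDensity
      (fun x => ENNReal.ofReal (Real.exp (inner ℝ u x - ‖u‖ ^ 2 / 2))) := by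
  have hs : ∀ i : Fin p, SigmaFinite ((gaussianReal 0 1).withDensity
      (fun x => ENNReal.ofReal (Real.exp (u i * x - u i ^ 2 / 2)))) := fun i => by
    rw [← gaussianReal_shift_density]; infer_instance
  have hpi : (Measure.pi fun _ : Fin p => gaussianReal 0 1).map (fun x i => x i + u i) =
      (Measure.pi fun _ : Fin p => gaussianReal 0 1).withDensity
        (fun x => ∏ i, ENNReal.ofReal (Real.exp (u i * x i - u i ^ 2 / 2))) := by
    rw [← pi_withDensity_eq (fun _ => gaussianReal 0 1)
        (fun i x => ENNReal.ofReal (Real.exp (u i * x - u i ^ 2 / 2))) (fun i => by fun_prop),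
      Measure.pi_map_pi (f := fun i x => x + u i) (fun i => by fun_prop)]
    congr 1
    ext1 i
    rw [gaussianReal_map_add_const, zero_add, gaussianReal_shift_density]
  have hm : Measurable (WithLp.toLp 2 : (Fin p → ℝ) → 𝔼) := by fun_prop
  rw [← map_pi_eq_stdGaussian, Measure.map_map (by fun_prop) hm]
  have hc : (fun x : 𝔼 => x + u) ∘ (WithLp.toLp 2 : (Fin p → ℝ) → 𝔼) =
      (WithLp.toLp 2) ∘ (fun x : Fin p → ℝ => fun i => x i + u i) := by
    ext x i; simp
  rw [hc, ← Measure.map_map hm (by fun_prop), hpi]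
  ext s hs
  rw [Measure.map_apply hm hs, withDensity_apply _ (hm hs), withDensity_apply _ hs,
    setLIntegral_map hs (by fun_prop) hm]
  refine lintegral_congr fun x => ?_
  rw [← ENNReal.ofReal_prod_of_nonneg (fun _ _ => (Real.exp_pos _).le), ← Real.exp_sum]
  congr 2
  rw [Finset.sum_sub_distrib, EuclideanSpace.real_norm_sq_eq, Finset.sum_div]
  simp [PiLp.inner_apply, mul_comm]

/-- The density of a translate has total mass one, which determines the moment generating function.
-/
lemma lintegral_exp_inner_stdGaussian (u : 𝔼) :
    ∫⁻ x, ENNReal.ofReal (Real.exp (inner ℝ u x)) ∂(stdGaussian 𝔼) =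
      ENNReal.ofReal (Real.exp (‖u‖ ^ 2 / 2)) := by
  have h : (stdGaussian 𝔼).map (fun x => x + u) Set.univ = 1 := by
    rw [Measure.map_apply (by fun_prop) MeasurableSet.univ]; simp
  rw [stdGaussian_map_add_eq, withDensity_apply _ MeasurableSet.univ, Measure.restrict_univ] at h
  have h2 : ∀ x : 𝔼, ENNReal.ofReal (Real.exp (inner ℝ u x)) =
      ENNReal.ofReal (Real.exp (‖u‖ ^ 2 / 2)) *
        ENNReal.ofReal (Real.exp (inner ℝ u x - ‖u‖ ^ 2 / 2)) := fun x => by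
    rw [← ENNReal.ofReal_mul (Real.exp_pos _).le, ← Real.exp_add]; congr 2; ring
  simp_rw [h2]
  rw [lintegral_const_mul _ (by fun_prop), h, mul_one]

lemma lintegral_exp_mul_gaussianReal (c : ℝ) :
    ∫⁻ x, ENNReal.ofReal (Real.exp (c * x)) ∂(gaussianReal 0 1) =
      ENNReal.ofReal (Real.exp (c ^ 2 / 2)) := by
  have h : gaussianReal c 1 Set.univ = 1 := measure_univ
  rw [gaussianReal_shift_density, withDensity_apply _ MeasurableSet.univ,
    Measure.restrict_univ] at h
  have h2 : ∀ x : ℝ, ENNReal.ofReal (Real.exp (c * x)) =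
      ENNReal.ofReal (Real.exp (c ^ 2 / 2)) *
        ENNReal.ofReal (Real.exp (c * x - c ^ 2 / 2)) := fun x => by
    rw [← ENNReal.ofReal_mul (Real.exp_pos _).le, ← Real.exp_add]; congr 2; ring
  simp_rw [h2]
  rw [lintegral_const_mul _ (by fun_prop), h, mul_one]

lemma lintegral_exp_sq_gaussianReal {c : ℝ} (hc : c < 1 / 2) :
    ∫⁻ x, ENNReal.ofReal (Real.exp (c * x ^ 2)) ∂(gaussianReal 0 1) =
      ENNReal.ofReal ((Real.sqrt (1 - 2 * c))⁻¹) := by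
  rw [gaussianReal_of_var_ne_zero _ one_ne_zero,
    lintegral_withDensity_eq_lintegral_mul _ (measurable_gaussianPDF _ _) (by fun_prop)]
  have hb : 0 < 1 / 2 - c := by linarith
  have h2 : ∀ x : ℝ, (gaussianPDF 0 1 * fun x : ℝ => ENNReal.ofReal (Real.exp (c * x ^ 2))) x =
      ENNReal.ofReal ((Real.sqrt (2 * Real.pi))⁻¹ * Real.exp (-(1 / 2 - c) * x ^ 2)) := fun x => by
    simp only [Pi.mul_apply, gaussianPDF]
    rw [← ENNReal.ofReal_mul (gaussianPDFReal_nonneg _ _ _), gaussianPDFReal_def]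
    simp only []
    rw [mul_assoc, ← Real.exp_add]
    simp only [NNReal.coe_one, mul_one, sub_zero]
    congr 3
    ring
  simp_rw [h2]
  rw [← ofReal_integral_eq_lintegral_ofReal ((integrable_exp_neg_mul_sq hb).const_mul _)
    (Filter.Eventually.of_forall fun x => by positivity), integral_const_mul, integral_gaussian,
    ← Real.sqrt_inv, ← Real.sqrt_mul (by positivity), ← Real.sqrt_inv]
  congr 2
  have : 1 - 2 * c ≠ 0 := by linarith
  have : 1 / 2 - c ≠ 0 := by linarith
  field_simp

/-- After squaring, this is 1 ≤ (1 - 2c) exp(4c), which follows from (1 - 2c)(1 + 4c) ≥ 1 on 0 ≤ c ≤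
1/4. -/
lemma lintegral_exp_sq_gaussianReal_le {c : ℝ} (h0 : 0 ≤ c) (hc : c ≤ 1 / 4) :
    ∫⁻ x, ENNReal.ofReal (Real.exp (c * x ^ 2)) ∂(gaussianReal 0 1) ≤
      ENNReal.ofReal (Real.exp (2 * c)) := by
  rw [lintegral_exp_sq_gaussianReal (by linarith)]
  refine ENNReal.ofReal_le_ofReal ?_
  have h1 : 0 < 1 - 2 * c := by linarith
  rw [← Real.sqrt_inv, Real.sqrt_le_left (Real.exp_pos _).le, ← Real.exp_nat_mul,
    inv_le_iff_one_le_mul₀ h1]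
  have := Real.add_one_le_exp ((2 : ℕ) * (2 * c))
  push_cast at this ⊢
  nlinarith

/-- The likelihood ratio of `N(0, 1 + u uᵀ)` with respect to `N(0, 1)`, as a Gaussian mixture of
likelihood ratios of translates. -/
def spikeDensity (u x : EuclideanSpace ℝ (Fin p)) : ℝ≥0∞ :=
  ∫⁻ w, ENNReal.ofReal (Real.exp (w * inner ℝ u x - w ^ 2 * ‖u‖ ^ 2 / 2)) ∂(gaussianReal 0 1)

lemma measurable_spikeDensity (u : 𝔼) : Measurable (spikeDensity u) := by
  unfold spikeDensity
  refine Measurable.lintegral_prod_right' (f := fun z : 𝔼 × ℝ =>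
    ENNReal.ofReal (Real.exp (z.2 * inner ℝ u z.1 - z.2 ^ 2 * ‖u‖ ^ 2 / 2))) ?_
  fun_prop

lemma posSemidef_vecMulVec_real (u : Fin p → ℝ) : (Matrix.vecMulVec u u).PosSemidef := by
  simpa using Matrix.posSemidef_vecMulVec_self_star u

lemma dotProduct_vecMulVec_mulVec (u x : Fin p → ℝ) :
    dotProduct x (Matrix.mulVec (Matrix.vecMulVec u u) x) = (dotProduct u x) ^ 2 := by
  rw [Matrix.vecMulVec_mulVec]
  simp [dotProduct_comm x u, sq]

lemma charFun_gaussianReal_map_smul (u t : 𝔼) :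
    charFun ((gaussianReal 0 1).map (fun w : ℝ => w • u)) t =
      Complex.exp (-((dotProduct u.ofLp t.ofLp : ℝ) : ℂ) ^ 2 / 2) := by
  rw [charFun_apply, integral_map (by fun_prop) (by fun_prop)]
  simp_rw [real_inner_smul_left]
  have := charFun_gaussianReal (μ := 0) (v := 1) (inner ℝ u t)
  rw [charFun_apply_real] at this
  have hi : inner ℝ u t = dotProduct u.ofLp t.ofLp := by
    simp [PiLp.inner_apply, dotProduct, mul_comm]
  rw [← hi]
  convert this using 1
  · refine integral_congr_ae (Filter.Eventually.of_forall fun x => ?_)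
    simp; ring_nf
  · simp; ring_nf

/-- Writing the degenerate Gaussian as the law of w u lets two such laws share the same w in a
coupling. -/
lemma gaussianReal_map_smul_eq (u : 𝔼) :
    (gaussianReal 0 1).map (fun w : ℝ => w • u) =
      multivariateGaussian 0 (Matrix.vecMulVec u.ofLp u.ofLp) := by
  have : IsProbabilityMeasure ((gaussianReal 0 1).map (fun w : ℝ => w • u)) :=
    Measure.isProbabilityMeasure_map (by fun_prop)
  apply Measure.ext_of_charFun
  ext t
  rw [charFun_gaussianReal_map_smul, charFun_multivariateGaussian (posSemidef_vecMulVec_real _),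
    dotProduct_vecMulVec_mulVec]
  simp
  ring_nf

/-- White noise plus an independent random multiple of u: the characteristic functions multiply, so
the covariances add. -/
lemma stdGaussian_prod_map_eq (u : 𝔼) :
    ((stdGaussian 𝔼).prod (gaussianReal 0 1)).map (fun z => z.1 + z.2 • u) =
      multivariateGaussian 0 (1 + Matrix.vecMulVec u.ofLp u.ofLp) := by
  have : IsProbabilityMeasure ((gaussianReal 0 1).map (fun w : ℝ => w • u)) :=
    Measure.isProbabilityMeasure_map (by fun_prop)
  have h1 : ((stdGaussian 𝔼).prod (gaussianReal 0 1)).map (fun z => z.1 + z.2 • u) =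
      ((stdGaussian 𝔼).prod ((gaussianReal 0 1).map (fun w : ℝ => w • u))).map
        (fun z => z.1 + z.2) := by
    conv_rhs => rw [← Measure.map_id (μ := stdGaussian 𝔼)]
    rw [Measure.map_prod_map _ _ measurable_id (by fun_prop),
      Measure.map_map (by fun_prop) (by fun_prop)]
    rfl
  have : IsProbabilityMeasure
      (((stdGaussian 𝔼).prod ((gaussianReal 0 1).map (fun w : ℝ => w • u))).map
        (fun z => z.1 + z.2)) :=
    Measure.isProbabilityMeasure_map (by fun_prop)
  rw [h1]
  apply Measure.ext_of_charFun
  rw [charFun_map_add_prod_eq_mul]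
  ext t
  rw [Pi.mul_apply, charFun_gaussianReal_map_smul, charFun_stdGaussian,
    charFun_multivariateGaussian (Matrix.PosSemidef.one.add (posSemidef_vecMulVec_real _)),
    Matrix.add_mulVec, dotProduct_add, dotProduct_vecMulVec_mulVec, ← Complex.exp_add,
    ← Complex.ofReal_pow ‖t‖, EuclideanSpace.real_norm_sq_eq]
  congr 1
  simp [dotProduct, sq]
  ring

lemma multivariateGaussian_smul {a : ℝ} (ha : 0 ≤ a) {S : Matrix (Fin p) (Fin p) ℝ}
    (hS : S.PosSemidef) :
    multivariateGaussian 0 (a • S) =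
      (multivariateGaussian 0 S).map (fun x => Real.sqrt a • x) := by
  have : IsProbabilityMeasure ((multivariateGaussian 0 S).map (fun x => Real.sqrt a • x)) :=
    Measure.isProbabilityMeasure_map (by fun_prop)
  apply Measure.ext_of_charFun
  ext t
  rw [charFun_map_smul, charFun_multivariateGaussian hS, charFun_multivariateGaussian (hS.smul ha)]
  congr 1
  have : ((Real.sqrt a : ℝ) : ℂ) * (Real.sqrt a : ℝ) = a := by
    rw [← Complex.ofReal_mul, Real.mul_self_sqrt ha]
  simp [Matrix.smul_mulVec, Matrix.mulVec_smul]
  rw [← mul_assoc, this]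

/-- Given the multiplier w, the law is a translate of white noise by w u; Tonelli averages the
translate densities over w. -/
lemma multivariateGaussian_one_add_eq_withDensity (u : 𝔼) :
    multivariateGaussian 0 (1 + Matrix.vecMulVec u.ofLp u.ofLp) =
      (stdGaussian 𝔼).withDensity (spikeDensity u) := by
  rw [← stdGaussian_prod_map_eq]
  ext s hs
  have hm : Measurable (fun z : 𝔼 × ℝ => z.1 + z.2 • u) := by fun_prop
  rw [Measure.map_apply hm hs, Measure.prod_apply_symm (hm hs), withDensity_apply _ hs]
  unfold spikeDensity
  rw [lintegral_lintegral_swap (by fun_prop)]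
  refine lintegral_congr fun w => ?_
  have := congrArg (fun μ : Measure 𝔼 => μ s) (stdGaussian_map_add_eq (w • u))
  simp only at this
  rw [Measure.map_apply (by fun_prop) hs, withDensity_apply _ hs] at this
  refine Eq.trans this (lintegral_congr fun x => ?_)
  rw [real_inner_smul_left, norm_smul, mul_pow, Real.norm_eq_abs, sq_abs]

/-- By Tonelli the integral over x comes first: the ratios of the translates by w u and z v have
inner product exp(w z ⟨u, v⟩). Integrating over z leaves exp(⟨u, v⟩² w² / 2), and the hypothesis
keeps the coefficient of w² at most 1/4. -/
lemma lintegral_spikeDensity_mul_le (u v : 𝔼) (h : (inner ℝ u v) ^ 2 ≤ 1 / 2) :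
    ∫⁻ x, spikeDensity u x * spikeDensity v x ∂(stdGaussian 𝔼) ≤
      ENNReal.ofReal (Real.exp ((inner ℝ u v) ^ 2)) := by
  have h1 : ∀ x : 𝔼, spikeDensity u x * spikeDensity v x =
      ∫⁻ w, ∫⁻ z, ENNReal.ofReal (Real.exp (w * inner ℝ u x - w ^ 2 * ‖u‖ ^ 2 / 2)) *
        ENNReal.ofReal (Real.exp (z * inner ℝ v x - z ^ 2 * ‖v‖ ^ 2 / 2))
          ∂(gaussianReal 0 1) ∂(gaussianReal 0 1) := fun x => by
    unfold spikeDensity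
    rw [lintegral_lintegral_mul (by fun_prop) (by fun_prop)]
  have h2 : ∀ w z : ℝ, ∫⁻ x, ENNReal.ofReal (Real.exp (w * inner ℝ u x - w ^ 2 * ‖u‖ ^ 2 / 2)) *
        ENNReal.ofReal (Real.exp (z * inner ℝ v x - z ^ 2 * ‖v‖ ^ 2 / 2)) ∂(stdGaussian 𝔼) =
      ENNReal.ofReal (Real.exp ((w * inner ℝ u v) * z)) := fun w z => by
    have : ∀ x : 𝔼, ENNReal.ofReal (Real.exp (w * inner ℝ u x - w ^ 2 * ‖u‖ ^ 2 / 2)) *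
        ENNReal.ofReal (Real.exp (z * inner ℝ v x - z ^ 2 * ‖v‖ ^ 2 / 2)) =
        ENNReal.ofReal (Real.exp (-(w ^ 2 * ‖u‖ ^ 2 / 2) - z ^ 2 * ‖v‖ ^ 2 / 2)) *
          ENNReal.ofReal (Real.exp (inner ℝ (w • u + z • v) x)) := fun x => by
      rw [← ENNReal.ofReal_mul (Real.exp_pos _).le, ← ENNReal.ofReal_mul (Real.exp_pos _).le,
        ← Real.exp_add, ← Real.exp_add, inner_add_left, real_inner_smul_left,
        real_inner_smul_left]
      congr 2; ring
    simp_rw [this]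
    rw [lintegral_const_mul _ (by fun_prop), lintegral_exp_inner_stdGaussian,
      ← ENNReal.ofReal_mul (Real.exp_pos _).le, ← Real.exp_add, norm_add_sq_real, norm_smul,
      norm_smul, real_inner_smul_left, real_inner_smul_right, mul_pow, mul_pow,
      Real.norm_eq_abs, Real.norm_eq_abs, sq_abs, sq_abs]
    congr 2; ring
  calc ∫⁻ x, spikeDensity u x * spikeDensity v x ∂(stdGaussian 𝔼)
      = ∫⁻ w, ∫⁻ z, ENNReal.ofReal (Real.exp ((w * inner ℝ u v) * z))
          ∂(gaussianReal 0 1) ∂(gaussianReal 0 1) := by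
        simp_rw [h1]
        rw [lintegral_lintegral_swap]
        · refine lintegral_congr fun w => ?_
          rw [lintegral_lintegral_swap (by fun_prop)]
          exact lintegral_congr fun z => h2 w z
        · refine Measurable.aemeasurable ?_
          refine Measurable.lintegral_prod_right' (f := fun q : (𝔼 × ℝ) × ℝ =>
            ENNReal.ofReal (Real.exp (q.1.2 * inner ℝ u q.1.1 - q.1.2 ^ 2 * ‖u‖ ^ 2 / 2)) *
            ENNReal.ofReal (Real.exp (q.2 * inner ℝ v q.1.1 - q.2 ^ 2 * ‖v‖ ^ 2 / 2))) ?_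
          fun_prop
    _ = ∫⁻ w, ENNReal.ofReal (Real.exp ((inner ℝ u v) ^ 2 / 2 * w ^ 2)) ∂(gaussianReal 0 1) := by
        refine lintegral_congr fun w => ?_
        rw [lintegral_exp_mul_gaussianReal]
        congr 2; ring
    _ ≤ _ := by
        refine (lintegral_exp_sq_gaussianReal_le (by positivity) (by linarith)).trans_eq ?_
        congr 2; ring

end Densities


/-! ### Random sign vectors and the exponential moments of their overlaps -/

section SignVectors

variable {p d m : ℕ}

/-- The real number `1` or `-1` attached to a truth value. -/
def boolSign (b : Bool) : ℝ := if b then 1 else -1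

lemma abs_boolSign (b : Bool) : |boolSign b| = 1 := by cases b <;> simp [boolSign]

/-- The vector with one entry `±1` in each of `d` disjoint groups of `m` coordinates, the position
and the sign in each group being given by `f`. -/
def signVector (φ : Fin d × Fin m ↪ Fin p) (f : Fin d → Fin m × Bool) :
    EuclideanSpace ℝ (Fin p) :=
  ∑ i, boolSign (f i).2 • EuclideanSpace.single (φ (i, (f i).1)) 1

/-- The contribution of one group of coordinates to the inner product of two sign vectors. -/
def signOverlap (x y : Fin m × Bool) : ℝ :=
  if x.1 = y.1 then boolSign x.2 * boolSign y.2 else 0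

lemma abs_signOverlap_le (x y : Fin m × Bool) : |signOverlap x y| ≤ 1 := by
  unfold signOverlap
  split_ifs
  · rw [abs_mul, abs_boolSign, abs_boolSign, one_mul]
  · simp

lemma inner_signVector (φ : Fin d × Fin m ↪ Fin p) (f g : Fin d → Fin m × Bool) :
    inner ℝ (signVector φ f) (signVector φ g) = ∑ i, signOverlap (f i) (g i) := by
  unfold signVector
  rw [sum_inner]
  refine Finset.sum_congr rfl fun i _ => ?_
  rw [inner_sum, Finset.sum_eq_single i]
  · simp only [real_inner_smul_left, real_inner_smul_right, EuclideanSpace.inner_single_left,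
      PiLp.single_apply, φ.injective.eq_iff, Prod.mk.injEq, true_and, signOverlap]
    split_ifs <;> simp_all [mul_comm]
  · intro j _ hj
    simp only [real_inner_smul_left, real_inner_smul_right, EuclideanSpace.inner_single_left,
      PiLp.single_apply, φ.injective.eq_iff, Prod.mk.injEq]
    simp [Ne.symm hj]
  · simp

lemma norm_signVector_sq (φ : Fin d × Fin m ↪ Fin p) (f : Fin d → Fin m × Bool) :
    ‖signVector φ f‖ ^ 2 = d := by
  rw [← real_inner_self_eq_norm_sq, inner_signVector]
  have : ∀ i, signOverlap (f i) (f i) = 1 := fun i => by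
    unfold signOverlap boolSign
    rcases (f i).2 <;> simp
  simp [this]

lemma exists_of_signVector_ne_zero {φ : Fin d × Fin m ↪ Fin p} {f : Fin d → Fin m × Bool}
    {x : Fin p} (h : signVector φ f x ≠ 0) : ∃ i, φ (i, (f i).1) = x := by
  by_contra hx
  push Not at hx
  refine h ?_
  unfold signVector
  simp only [WithLp.ofLp_sum, Finset.sum_apply]
  exact Finset.sum_eq_zero fun i _ => by simp [(hx i).symm]

lemma abs_inner_signVector_le (φ : Fin d × Fin m ↪ Fin p) (f g : Fin d → Fin m × Bool) :
    |inner ℝ (signVector φ f) (signVector φ g)| ≤ d := by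
  rw [inner_signVector]
  calc |∑ i, signOverlap (f i) (g i)| ≤ ∑ i, |signOverlap (f i) (g i)| :=
        Finset.abs_sum_le_sum_abs _ _
    _ ≤ ∑ _i : Fin d, (1 : ℝ) := Finset.sum_le_sum fun i _ => abs_signOverlap_le _ _
    _ = d := by simp

/-- For s ≥ 0, cosh s - 1 = 2 sinh²(s/2) and sinh(s/2) ≤ (s/2) exp(s/2). -/
lemma cosh_sub_one_le (s : ℝ) : Real.cosh s - 1 ≤ s ^ 2 / 2 * Real.exp |s| := by
  wlog hs : 0 ≤ s with H
  · simpa using H (-s) (by linarith)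
  rw [abs_of_nonneg hs]
  have h1 : Real.sinh (s / 2) ≤ s / 2 * Real.exp (s / 2) := by
    have h := Real.add_one_le_exp (-s)
    have h2 : Real.exp (-(s / 2)) = Real.exp (-s) * Real.exp (s / 2) := by
      rw [← Real.exp_add]; ring_nf
    rw [Real.sinh_eq, h2]
    nlinarith [Real.exp_pos (s / 2)]
  have h0 : 0 ≤ Real.sinh (s / 2) := Real.sinh_nonneg_iff.2 (by linarith)
  have h3 : Real.cosh s = 1 + 2 * Real.sinh (s / 2) ^ 2 := by
    have := Real.cosh_two_mul (s / 2)
    rw [mul_div_cancel₀ s (by norm_num : (2 : ℝ) ≠ 0)] at this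
    rw [this, Real.cosh_sq]; ring
  have h4 : Real.exp s = Real.exp (s / 2) ^ 2 := by rw [← Real.exp_nat_mul]; congr 1; push_cast; ring
  rw [h3, h4]
  have := pow_le_pow_left₀ h0 h1 2
  nlinarith

/-- A variable that is `±1` with probability `1 / m` and `0` otherwise is sub-Gaussian with variance
proxy of order `1 / log m`. -/
lemma one_add_cosh_sub_one_div_le {x : ℝ} (hx : 2 ≤ x) (s : ℝ) :
    1 + (Real.cosh s - 1) / x ≤ Real.exp (2 * s ^ 2 / Real.log x) := by
  have hL : 0 < Real.log x := Real.log_pos (by linarith)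
  have hx0 : 0 < x := by linarith
  -- For small |s|, exp |s| ≤ √x and log x ≤ 2√x, so the factor 1/x absorbs the growth of cosh. For
  -- large |s| the crude bound exp |s| suffices, since |s| ≤ 2 s² / log x there.
  rcases le_total |s| (Real.log x / 2) with h | h
  · have h1 : Real.exp |s| ≤ Real.sqrt x := by
      rw [Real.sqrt_eq_rpow, Real.rpow_def_of_pos hx0]
      exact Real.exp_le_exp.2 (by linarith)
    have hsq : 0 < Real.sqrt x := Real.sqrt_pos.2 hx0
    have hlog : Real.log x ≤ 2 * Real.sqrt x := by
      have := Real.log_le_sub_one_of_pos hsq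
      rw [Real.log_sqrt hx0.le] at this
      linarith
    have h2 : (Real.cosh s - 1) / x ≤ 2 * s ^ 2 / Real.log x := by
      rw [div_le_div_iff₀ hx0 hL]
      calc (Real.cosh s - 1) * Real.log x
          ≤ (s ^ 2 / 2 * Real.sqrt x) * (2 * Real.sqrt x) := by
            refine mul_le_mul ((cosh_sub_one_le s).trans (by gcongr)) hlog hL.le (by positivity)
        _ = s ^ 2 * (Real.sqrt x * Real.sqrt x) := by ring
        _ = s ^ 2 * x := by rw [Real.mul_self_sqrt hx0.le]
        _ ≤ 2 * s ^ 2 * x := by nlinarith [sq_nonneg s]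
    have := Real.add_one_le_exp (2 * s ^ 2 / Real.log x)
    linarith
  · have h1 : 1 + (Real.cosh s - 1) / x ≤ Real.exp |s| := by
      have hc : Real.cosh s ≤ Real.exp |s| := by
        rw [← Real.cosh_abs, Real.cosh_eq]
        have := Real.exp_le_exp.2 (neg_le_self (abs_nonneg s))
        linarith
      have := div_le_self (sub_nonneg.2 (Real.one_le_cosh s)) (by linarith : 1 ≤ x)
      linarith
    refine h1.trans (Real.exp_le_exp.2 ?_)
    rw [le_div_iff₀ hL, ← sq_abs s]
    nlinarith [abs_nonneg s]

lemma sum_exp_signOverlap (x : Fin m × Bool) (s : ℝ) :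
    ∑ y : Fin m × Bool, Real.exp (s * signOverlap x y) =
      2 * m * (1 + (Real.cosh s - 1) / m) := by
  have hm : (m : ℝ) ≠ 0 := by
    have := x.1.pos
    positivity
  have h1 : ∀ j : Fin m, ∑ b : Bool, Real.exp (s * signOverlap x (j, b)) =
      2 + if x.1 = j then 2 * (Real.cosh s - 1) else 0 := fun j => by
    obtain ⟨i, b⟩ := x
    rw [Fintype.sum_bool]
    by_cases h : i = j
    · cases b <;> simp [signOverlap, boolSign, h, Real.cosh_eq] <;> ring
    · simp [signOverlap, h]; norm_num
  rw [Fintype.sum_prod_type]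
  simp_rw [h1]
  rw [Finset.sum_add_distrib, Finset.sum_ite_eq]
  simp only [Finset.sum_const, Finset.card_univ, Fintype.card_fin, nsmul_eq_mul, Finset.mem_univ,
    if_true]
  field_simp

lemma sum_exp_inner_signVector_le (hm : 2 ≤ m) (φ : Fin d × Fin m ↪ Fin p)
    (f : Fin d → Fin m × Bool) (s : ℝ) :
    ∑ g, Real.exp (s * inner ℝ (signVector φ f) (signVector φ g)) ≤
      (2 * m) ^ d * Real.exp (2 * d * s ^ 2 / Real.log m) := by
  have hm' : (2 : ℝ) ≤ m := by exact_mod_cast hm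
  have h := Finset.prod_univ_sum (fun _ : Fin d => (Finset.univ : Finset (Fin m × Bool)))
    (fun i y => Real.exp (s * signOverlap (f i) y))
  simp only [sum_exp_signOverlap, Fintype.piFinset_univ, Finset.prod_const, Finset.card_univ,
    Fintype.card_fin, ← Real.exp_sum, ← Finset.mul_sum] at h
  simp_rw [inner_signVector]
  rw [← h, mul_pow]
  refine mul_le_mul_of_nonneg_left ?_ (by positivity)
  have h0 : 0 ≤ 1 + (Real.cosh s - 1) / m := by
    have := Real.one_le_cosh s
    have : 0 ≤ (Real.cosh s - 1) / m := div_nonneg (by linarith) (by linarith)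
    linarith
  refine (pow_le_pow_left₀ h0 (one_add_cosh_sub_one_div_le hm' s) d).trans_eq ?_
  rw [← Real.exp_nat_mul]
  congr 1; ring

/-- The squared overlap of a fixed sign vector with a random one has an exponential moment. -/
lemma sum_exp_sq_inner_signVector_le (hm : 2 ≤ m) (φ : Fin d × Fin m ↪ Fin p)
    (f : Fin d → Fin m × Bool) {t : ℝ} (ht0 : 0 ≤ t) (ht : t * d ≤ Real.log m / 16) :
    ∑ g, ENNReal.ofReal (Real.exp (t * (inner ℝ (signVector φ f) (signVector φ g)) ^ 2)) ≤
      ENNReal.ofReal ((2 * m) ^ d * 2) := by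
  have hL : 0 < Real.log m := Real.log_pos (by exact_mod_cast hm)
  -- Gaussian linearization: the square in the exponent becomes a Gaussian average of linear
  -- exponents, to which the sub-Gaussian bound applies for each w.
  have h1 : ∀ y : ℝ, ENNReal.ofReal (Real.exp (t * y ^ 2)) =
      ∫⁻ w, ENNReal.ofReal (Real.exp ((Real.sqrt (2 * t) * y) * w)) ∂(gaussianReal 0 1) :=
    fun y => by
      rw [lintegral_exp_mul_gaussianReal, mul_pow, Real.sq_sqrt (by positivity)]
      congr 2; ring
  simp_rw [h1]
  rw [← lintegral_finsetSum _ (fun g _ => by fun_prop)]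
  calc ∫⁻ w, ∑ g, ENNReal.ofReal (Real.exp
          ((Real.sqrt (2 * t) * inner ℝ (signVector φ f) (signVector φ g)) * w)) ∂(gaussianReal 0 1)
      ≤ ∫⁻ w, ENNReal.ofReal ((2 * m) ^ d) *
          ENNReal.ofReal (Real.exp (4 * (t * d) / Real.log m * w ^ 2)) ∂(gaussianReal 0 1) := by
        refine lintegral_mono fun w => ?_
        rw [← ENNReal.ofReal_sum_of_nonneg fun _ _ => (Real.exp_pos _).le,
          ← ENNReal.ofReal_mul (by positivity)]
        refine ENNReal.ofReal_le_ofReal ?_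
        convert sum_exp_inner_signVector_le hm φ f (Real.sqrt (2 * t) * w) using 3
        · ring_nf
        · rw [mul_pow, Real.sq_sqrt (by positivity)]; ring
    _ ≤ ENNReal.ofReal ((2 * m) ^ d) *
          ENNReal.ofReal (Real.exp (2 * (4 * (t * d) / Real.log m))) := by
        rw [lintegral_const_mul _ (by fun_prop)]
        gcongr
        -- The 16 in `ht` makes the coefficient at most 1/4; the resulting factor is at most
        -- exp(1/2) ≤ 2.
        refine lintegral_exp_sq_gaussianReal_le (by positivity) ?_
        rw [div_le_iff₀ hL]; linarith
    _ ≤ _ := by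
        rw [← ENNReal.ofReal_mul (by positivity)]
        refine ENNReal.ofReal_le_ofReal ?_
        refine mul_le_mul_of_nonneg_left ?_ (by positivity)
        have h2 : 2 * (4 * (t * d) / Real.log m) ≤ 1 / 2 := by
          rw [mul_div_assoc', div_le_iff₀ hL]; linarith
        refine (Real.exp_le_exp.2 h2).trans ?_
        have h3 : Real.exp (1 / 2) ^ 2 = Real.exp 1 := by
          rw [← Real.exp_nat_mul]; norm_num
        have := Real.exp_one_lt_d9
        nlinarith [Real.exp_pos (1 / 2)]

end SignVectors

/-! ### Mixtures of spiked Gaussian samples against white noise -/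

section Mixture

variable {n p d m : ℕ}

local notation "𝔼" => EuclideanSpace ℝ (Fin p)

/-- The arithmetic-geometric mean inequality. With x the sum of N likelihood ratios and second
moment at most 2N², integrating it over an event bounds the average probability by 1/2 plus the null
probability. -/
lemma le_sq_div_add {N : ℝ} (hN : 0 < N) (x : ℝ≥0∞) :
    x ≤ ENNReal.ofReal (1 / (4 * N)) * (x * x) + ENNReal.ofReal N := by
  have hN' : 0 < 1 / (4 * N) := by positivity
  induction x with
  | top => simp [ENNReal.mul_top, ENNReal.ofReal_eq_zero, hN]
  | coe x =>
    rw [← ENNReal.ofReal_coe_nnreal, ← ENNReal.ofReal_mul x.coe_nonneg, ← ENNReal.ofReal_mul hN'.le,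
      ← ENNReal.ofReal_add (by positivity) hN.le]
    refine ENNReal.ofReal_le_ofReal ?_
    have h : 1 / (4 * N) * ((x : ℝ) * x) + N - x = 1 / (4 * N) * (x - 2 * N) ^ 2 := by
      field_simp; ring
    have : 0 ≤ 1 / (4 * N) * ((x : ℝ) - 2 * N) ^ 2 := by positivity
    linarith

/-- A second moment bound controls the mixture of measures with densities on every event. -/
lemma sum_withDensity_le {Ω ι : Type*} [MeasurableSpace Ω] [Fintype ι] (μ : Measure Ω)
    (Λ : ι → Ω → ℝ≥0∞) (hΛ : ∀ f, Measurable (Λ f)) {N : ℝ} (hN : 0 < N)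
    (h2 : ∑ f, ∑ g, ∫⁻ x, Λ f x * Λ g x ∂μ ≤ ENNReal.ofReal (2 * N ^ 2))
    {A : Set Ω} (hA : MeasurableSet A) :
    ∑ f, μ.withDensity (Λ f) A ≤ ENNReal.ofReal (N / 2) + ENNReal.ofReal N * μ A := by
  have hm : Measurable fun x => ∑ f, Λ f x := Finset.measurable_sum _ fun f _ => hΛ f
  calc ∑ f, μ.withDensity (Λ f) A = ∫⁻ x in A, ∑ f, Λ f x ∂μ := by
        rw [lintegral_finsetSum _ fun f _ => hΛ f]
        exact Finset.sum_congr rfl fun f _ => withDensity_apply _ hA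
    _ ≤ ∫⁻ x in A, (ENNReal.ofReal (1 / (4 * N)) * ((∑ f, Λ f x) * ∑ g, Λ g x) +
          ENNReal.ofReal N) ∂μ := lintegral_mono fun x => le_sq_div_add hN _
    _ = ENNReal.ofReal (1 / (4 * N)) * (∫⁻ x in A, (∑ f, Λ f x) * ∑ g, Λ g x ∂μ) +
          ENNReal.ofReal N * μ A := by
        rw [lintegral_add_right _ measurable_const, lintegral_const_mul _ (by fun_prop)]
        simp
    _ ≤ ENNReal.ofReal (1 / (4 * N)) * ENNReal.ofReal (2 * N ^ 2) + ENNReal.ofReal N * μ A := by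
        gcongr
        refine (setLIntegral_le_lintegral _ _).trans (le_trans (le_of_eq ?_) h2)
        simp_rw [Finset.sum_mul_sum]
        rw [lintegral_finsetSum _ fun f _ =>
          by fun_prop]
        exact Finset.sum_congr rfl fun f _ =>
          lintegral_finsetSum _ fun g _ => (hΛ f).mul (hΛ g)
    _ = _ := by
        rw [← ENNReal.ofReal_mul (by positivity)]
        congr 2
        field_simp; norm_num

/-- The spiked covariance matrix `1 + τ e eᵀ` for a sign vector `e`. -/
def spikedCov (φ : Fin d × Fin m ↪ Fin p) (τ : ℝ) (f : Fin d → Fin m × Bool) :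
    Matrix (Fin p) (Fin p) ℝ :=
  1 + τ • Matrix.vecMulVec (signVector φ f).ofLp (signVector φ f).ofLp

lemma posSemidef_spikedCov (φ : Fin d × Fin m ↪ Fin p) {τ : ℝ} (hτ : 0 ≤ τ)
    (f : Fin d → Fin m × Bool) : (spikedCov φ τ f).PosSemidef :=
  Matrix.PosSemidef.one.add ((posSemidef_vecMulVec_real _).smul hτ)

lemma spikedCov_zero (φ : Fin d × Fin m ↪ Fin p) (f : Fin d → Fin m × Bool) :
    spikedCov φ 0 f = 1 := by simp [spikedCov]

lemma multivariateGaussian_spikedCov (φ : Fin d × Fin m ↪ Fin p) {τ : ℝ} (hτ : 0 ≤ τ)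
    (f : Fin d → Fin m × Bool) :
    multivariateGaussian 0 (spikedCov φ τ f) =
      (stdGaussian 𝔼).withDensity (spikeDensity (Real.sqrt τ • signVector φ f)) := by
  rw [← multivariateGaussian_one_add_eq_withDensity, spikedCov]
  congr 2
  rw [WithLp.ofLp_smul, Matrix.smul_vecMulVec, Matrix.vecMulVec_smul, smul_smul,
    Real.mul_self_sqrt hτ]

/-- The mixture over all sign vectors of the laws of `n` observations from the spiked Gaussians is
not much larger than the law of `n` standard Gaussian observations. -/
lemma sum_pi_spikedCov_le (hm : 2 ≤ m) (φ : Fin d × Fin m ↪ Fin p) {τ : ℝ}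
    (hτ : 0 ≤ τ) (hτ1 : τ * d ≤ 1 / 2) (hn : n * (τ ^ 2 * d) ≤ Real.log m / 16)
    {A : Set (Fin n → 𝔼)} (hA : MeasurableSet A) :
    ∑ f, Measure.pi (fun _ : Fin n => multivariateGaussian 0 (spikedCov φ τ f)) A ≤
      ENNReal.ofReal ((2 * m) ^ d / 2) +
        ENNReal.ofReal ((2 * m) ^ d) * Measure.pi (fun _ : Fin n => stdGaussian 𝔼) A := by
  have hm0 : (0 : ℝ) < m := by
    have : 0 < m := by omega
    exact_mod_cast this
  have h1 : ∀ f, Measure.pi (fun _ : Fin n => multivariateGaussian 0 (spikedCov φ τ f)) =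
      (Measure.pi (fun _ : Fin n => stdGaussian 𝔼)).withDensity
        (fun x => ∏ i, spikeDensity (Real.sqrt τ • signVector φ f) (x i)) := fun f => by
    have : SigmaFinite ((stdGaussian 𝔼).withDensity
        (spikeDensity (Real.sqrt τ • signVector φ f))) := by
      rw [← multivariateGaussian_spikedCov φ hτ f]; infer_instance
    rw [multivariateGaussian_spikedCov φ hτ f]
    exact pi_withDensity_eq (fun _ : Fin n => stdGaussian 𝔼)
      (fun _ => spikeDensity (Real.sqrt τ • signVector φ f)) fun _ => measurable_spikeDensity _
  simp_rw [h1]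
  refine sum_withDensity_le _ _ (fun f => Finset.measurable_prod _ fun i _ =>
    (measurable_spikeDensity _).comp (measurable_pi_apply i)) (by positivity) ?_ hA
  -- Independence reduces the integral to an n-th power of the one-observation bound. The condition
  -- τ d ≤ 1/2 bounds the overlap of the rescaled vectors, as that bound requires.
  have h2 : ∀ f g, ∫⁻ x, (∏ i, spikeDensity (Real.sqrt τ • signVector φ f) (x i)) *
        (∏ i, spikeDensity (Real.sqrt τ • signVector φ g) (x i))
          ∂(Measure.pi (fun _ : Fin n => stdGaussian 𝔼)) ≤
      ENNReal.ofReal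
        (Real.exp (n * τ ^ 2 * (inner ℝ (signVector φ f) (signVector φ g)) ^ 2)) := fun f g => by
    set u := Real.sqrt τ • signVector φ f
    set v := Real.sqrt τ • signVector φ g
    have huv : inner ℝ u v = τ * inner ℝ (signVector φ f) (signVector φ g) := by
      simp only [u, v, real_inner_smul_left, real_inner_smul_right]
      rw [← mul_assoc, Real.mul_self_sqrt hτ]
    have huv2 : (inner ℝ u v) ^ 2 ≤ 1 / 2 := by
      have h3 : |inner ℝ u v| ≤ 1 / 2 := by
        rw [huv, abs_mul, abs_of_nonneg hτ]
        exact (mul_le_mul_of_nonneg_left (abs_inner_signVector_le φ f g) hτ).trans hτ1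
      rw [← sq_abs]
      nlinarith [abs_nonneg (inner ℝ u v)]
    have hmeas : Measurable fun x => spikeDensity u x * spikeDensity v x :=
      (measurable_spikeDensity u).mul (measurable_spikeDensity v)
    simp_rw [← Finset.prod_mul_distrib]
    rw [lintegral_prod_eq_prod_lintegral_of_indepFun Finset.univ
      (fun i (x : Fin n → 𝔼) => spikeDensity u (x i) * spikeDensity v (x i))
      (iIndepFun_pi (X := fun _ x => spikeDensity u x * spikeDensity v x)
        fun i => hmeas.aemeasurable)
      (fun i => hmeas.comp (measurable_pi_apply i))]
    calc ∏ i : Fin n, ∫⁻ x : Fin n → 𝔼, spikeDensity u (x i) * spikeDensity v (x i)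
            ∂(Measure.pi (fun _ : Fin n => stdGaussian 𝔼))
        ≤ ∏ _i : Fin n, ENNReal.ofReal (Real.exp ((inner ℝ u v) ^ 2)) := by
          refine Finset.prod_le_prod' fun i _ => ?_
          exact ((measurePreserving_eval (fun _ : Fin n => stdGaussian 𝔼) i).lintegral_comp
            hmeas).trans_le (lintegral_spikeDensity_mul_le u v huv2)
      _ = _ := by
          rw [Finset.prod_const, Finset.card_univ, Fintype.card_fin,
            ← ENNReal.ofReal_pow (Real.exp_pos _).le, ← Real.exp_nat_mul, huv]
          congr 2; ring
  calc _ ≤ ∑ _f : Fin d → Fin m × Bool, ENNReal.ofReal ((2 * m) ^ d * 2) := by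
        refine Finset.sum_le_sum fun f _ => (Finset.sum_le_sum fun g _ => h2 f g).trans ?_
        exact sum_exp_sq_inner_signVector_le hm φ f (by positivity) (by linarith)
    _ = _ := by
        have hc : Fintype.card (Fin d → Fin m × Bool) = (2 * m) ^ d := by simp [mul_comm]
        rw [Finset.sum_const, Finset.card_univ, hc, nsmul_eq_mul,
          ← ENNReal.ofReal_natCast, ← ENNReal.ofReal_mul (by positivity)]
        congr 1; push_cast; ring

lemma pi_multivariateGaussian_smul {a : ℝ} (ha : 0 ≤ a) {S : Matrix (Fin p) (Fin p) ℝ}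
    (hS : S.PosSemidef) {A : Set (Fin n → 𝔼)} (hA : MeasurableSet A) :
    Measure.pi (fun _ : Fin n => multivariateGaussian 0 (a • S)) A =
      Measure.pi (fun _ : Fin n => multivariateGaussian 0 S)
        ((fun x i => Real.sqrt a • x i) ⁻¹' A) := by
  have : IsProbabilityMeasure ((multivariateGaussian 0 S).map (fun x => Real.sqrt a • x)) :=
    Measure.isProbabilityMeasure_map (by fun_prop)
  rw [multivariateGaussian_smul ha hS, ← Measure.map_apply (by fun_prop) hA,
    Measure.pi_map_pi (f := fun _ x => Real.sqrt a • x) fun i => by fun_prop]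

end Mixture


/-! ### The spectral norm and spiked matrices -/

section SpectralNorm

variable {p : ℕ}

lemma spectralNorm₂_sub_le (A B C : Matrix (Fin p) (Fin p) ℝ) :
    spectralNorm₂ (A - B) ≤ spectralNorm₂ (A - C) + spectralNorm₂ (B - C) := by
  unfold spectralNorm₂
  simp only [map_sub]
  rw [norm_sub_rev (Matrix.toEuclideanCLM (n := Fin p) (𝕜 := ℝ) B)]
  exact norm_sub_le_norm_sub_add_norm_sub _ _ _

lemma spectralNorm₂_smul {a : ℝ} (ha : 0 ≤ a) (A : Matrix (Fin p) (Fin p) ℝ) :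
    spectralNorm₂ (a • A) = a * spectralNorm₂ A := by
  unfold spectralNorm₂
  rw [map_smul, norm_smul, Real.norm_of_nonneg ha]

lemma spectralNorm₂_vecMulVec (u : EuclideanSpace ℝ (Fin p)) :
    spectralNorm₂ (Matrix.vecMulVec u.ofLp u.ofLp) = ‖u‖ ^ 2 := by
  have h : Matrix.toEuclideanCLM (n := Fin p) (𝕜 := ℝ) (Matrix.vecMulVec u.ofLp u.ofLp) =
      (innerSL ℝ u).smulRight u := by
    ext x i
    rw [Matrix.ofLp_toEuclideanCLM, Matrix.vecMulVec_mulVec]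
    simp [PiLp.inner_apply, dotProduct, mul_comm]
  rw [spectralNorm₂, h, ContinuousLinearMap.norm_smulRight_apply, innerSL_apply_norm, sq]

lemma spectralNorm₂_add_le (A B : Matrix (Fin p) (Fin p) ℝ) :
    spectralNorm₂ (A + B) ≤ spectralNorm₂ A + spectralNorm₂ B := by
  unfold spectralNorm₂
  rw [map_add]
  exact norm_add_le _ _

/-- The norm is a continuous function of the entries, because linear maps on finite-dimensional
spaces are continuous. -/
lemma measurable_spectralNorm₂_comp {Ω : Type*} [MeasurableSpace Ω]
    {T : Ω → Matrix (Fin p) (Fin p) ℝ} (hT : ∀ i j, Measurable fun x => T x i j) :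
    Measurable fun x => spectralNorm₂ (T x) := by
  let L : (Fin p → Fin p → ℝ) →ₗ[ℝ]
      (EuclideanSpace ℝ (Fin p) →L[ℝ] EuclideanSpace ℝ (Fin p)) :=
    { toFun := fun A => Matrix.toEuclideanCLM (n := Fin p) (𝕜 := ℝ) (Matrix.of A)
      map_add' := fun A B => map_add (Matrix.toEuclideanCLM (n := Fin p) (𝕜 := ℝ)) _ _
      map_smul' := fun c A => map_smul (Matrix.toEuclideanCLM (n := Fin p) (𝕜 := ℝ)) c _ }
  have hL : Continuous fun A : Fin p → Fin p → ℝ => ‖L A‖ :=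
    (LinearMap.continuous_of_finiteDimensional L).norm
  exact hL.measurable.comp
    (measurable_pi_lambda _ fun i => measurable_pi_lambda _ fun j => hT i j)

lemma measurableSet_spectral_error {n : ℕ}
    {T : (Fin n → EuclideanSpace ℝ (Fin p)) → Matrix (Fin p) (Fin p) ℝ} (hT : IsEstimator T)
    (S : Matrix (Fin p) (Fin p) ℝ) (r : ℝ) : MeasurableSet {x | r ≤ spectralNorm₂ (S - T x)} :=
  measurableSet_le measurable_const
    (measurable_spectralNorm₂_comp fun i j => (measurable_const (a := S i j)).sub (hT i j))

variable {d m : ℕ}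

lemma spectralNorm₂_smul_spikedCov_sub {a τ : ℝ} (ha : 0 ≤ a) (hτ : 0 ≤ τ)
    (φ : Fin d × Fin m ↪ Fin p) (f : Fin d → Fin m × Bool) :
    spectralNorm₂ (a • spikedCov φ τ f - a • 1) = a * (τ * d) := by
  rw [← smul_sub, spikedCov, add_sub_cancel_left, spectralNorm₂_smul ha, spectralNorm₂_smul hτ,
    spectralNorm₂_vecMulVec, norm_signVector_sq]

lemma spectralNorm₂_smul_spikedCov_le {a τ : ℝ} (ha : 0 ≤ a) (hτ : 0 ≤ τ)
    (φ : Fin d × Fin m ↪ Fin p) (f : Fin d → Fin m × Bool) :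
    spectralNorm₂ (a • spikedCov φ τ f) ≤ a * (1 + τ * d) := by
  rw [spectralNorm₂_smul ha]
  refine mul_le_mul_of_nonneg_left ?_ ha
  refine (spectralNorm₂_add_le _ _).trans ?_
  rw [spectralNorm₂_smul hτ, spectralNorm₂_vecMulVec, norm_signVector_sq]
  gcongr
  rw [spectralNorm₂, map_one]
  exact ContinuousLinearMap.norm_id_le

/-- The sign vector, nonzero since d ≥ 1, is an eigenvector of the spiked matrix with eigenvalue 1 +
τ‖e‖² ≥ 1. -/
lemma le_spectralNorm₂_smul_spikedCov {a τ : ℝ} (ha : 0 ≤ a) (hτ : 0 ≤ τ) (hd : 1 ≤ d)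
    (φ : Fin d × Fin m ↪ Fin p) (f : Fin d → Fin m × Bool) :
    a ≤ spectralNorm₂ (a • spikedCov φ τ f) := by
  rw [spectralNorm₂_smul ha]
  refine le_mul_of_one_le_right ha ?_
  set e := signVector φ f
  have he : 0 < ‖e‖ := by
    have h : ‖e‖ ^ 2 = d := norm_signVector_sq φ f
    have hd' : (0 : ℝ) < d := by exact_mod_cast hd
    by_contra h0
    have : ‖e‖ = 0 := le_antisymm (not_lt.1 h0) (norm_nonneg _)
    rw [this] at h
    norm_num at h
    linarith
  have h1 : Matrix.toEuclideanCLM (n := Fin p) (𝕜 := ℝ) (spikedCov φ τ f) e =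
      (1 + τ * ‖e‖ ^ 2) • e := by
    ext i
    rw [Matrix.ofLp_toEuclideanCLM, spikedCov, Matrix.add_mulVec, Matrix.smul_mulVec,
      Matrix.vecMulVec_mulVec, EuclideanSpace.real_norm_sq_eq]
    simp [dotProduct, e, ← sq]
    ring
  have h2 := (Matrix.toEuclideanCLM (n := Fin p) (𝕜 := ℝ) (spikedCov φ τ f)).le_opNorm e
  rw [h1, norm_smul, mul_le_mul_iff_left₀ he, Real.norm_of_nonneg (by positivity)] at h2
  have : 0 ≤ τ * ‖e‖ ^ 2 := by positivity
  exact le_trans (by linarith) h2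

end SpectralNorm

/-! ### Wasserstein distance between Gaussian laws on a line -/

section Wasserstein

variable {p : ℕ}

lemma wassersteinOne_map_le {Ω : Type*} [MeasurableSpace Ω] (μ : Measure Ω)
    {X Y : Ω → EuclideanSpace ℝ (Fin p)} (hX : Measurable X) (hY : Measurable Y) :
    wassersteinOne (μ.map X) (μ.map Y) ≤ ∫⁻ ω, edist (X ω) (Y ω) ∂μ := by
  unfold wassersteinOne
  have hXY : Measurable fun ω => (X ω, Y ω) := hX.prodMk hY
  refine (iInf₂_le (μ.map fun ω => (X ω, Y ω)) ?_).trans ((iInf_le _ ?_).trans_eq ?_)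
  · rw [Measure.map_map measurable_fst hXY]; rfl
  · rw [Measure.map_map measurable_snd hXY]; rfl
  · rw [lintegral_map (by fun_prop) hXY]

lemma wassersteinOne_self (μ : Measure (EuclideanSpace ℝ (Fin p))) : wassersteinOne μ μ = 0 := by
  have := wassersteinOne_map_le μ measurable_id measurable_id
  simpa using this

/-- From |w| ≤ (1 + w²)/2 and unit variance. -/
lemma lintegral_abs_gaussianReal_le :
    ∫⁻ w, ENNReal.ofReal |w| ∂(gaussianReal 0 1) ≤ 1 := by
  have hsq : Integrable (fun w : ℝ => w ^ 2) (gaussianReal 0 1) :=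
    (memLp_id_gaussianReal 2).integrable_sq
  have hvar : ∫ w : ℝ, w ^ 2 ∂(gaussianReal 0 1) = 1 := by
    have h := variance_fun_id_gaussianReal (μ := 0) (v := 1)
    rw [variance_eq_integral measurable_id'.aemeasurable] at h
    simpa using h
  calc ∫⁻ w, ENNReal.ofReal |w| ∂(gaussianReal 0 1)
      ≤ ∫⁻ w, ENNReal.ofReal ((1 + w ^ 2) / 2) ∂(gaussianReal 0 1) := by
        refine lintegral_mono fun w => ENNReal.ofReal_le_ofReal ?_
        nlinarith [sq_nonneg (|w| - 1), sq_abs w]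
    _ = 1 := by
        rw [← ofReal_integral_eq_lintegral_ofReal
          (f := fun w : ℝ => (1 + w ^ 2) / 2) (((integrable_const 1).add hsq).div_const 2)
          (Filter.Eventually.of_forall fun w => by positivity), integral_div,
          integral_add (integrable_const 1) hsq, hvar]
        norm_num

lemma wassersteinOne_line_le {u : EuclideanSpace ℝ (Fin p)} (hu : ‖u‖ = 1) (b c : ℝ) :
    wassersteinOne
        (multivariateGaussian 0 (Matrix.vecMulVec (b • u).ofLp (b • u).ofLp))
        (multivariateGaussian 0 (Matrix.vecMulVec (c • u).ofLp (c • u).ofLp)) ≤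
      ENNReal.ofReal |b - c| := by
  rw [← gaussianReal_map_smul_eq, ← gaussianReal_map_smul_eq]
  refine (wassersteinOne_map_le _ (by fun_prop) (by fun_prop)).trans ?_
  have h : ∀ w : ℝ, edist (w • b • u) (w • c • u) =
      ENNReal.ofReal |b - c| * ENNReal.ofReal |w| := fun w => by
    rw [edist_dist, dist_eq_norm, ← smul_sub, ← sub_smul, norm_smul, norm_smul, hu,
      ← ENNReal.ofReal_mul (abs_nonneg _)]
    simp [mul_comm]
  simp_rw [h]
  rw [lintegral_const_mul _ (by fun_prop)]
  exact mul_le_of_le_one_right' lintegral_abs_gaussianReal_le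

end Wasserstein

/-! ### Reduction of the minimax bound to two-point and mixture tests -/

section Minimax

variable {n p d m : ℕ} {F : Set (Matrix (Fin p) (Fin p) ℝ)} {ε r : ℝ}

/-- A lower bound for the minimax error probability from the distributions that an estimator
cannot tell apart. -/
lemma le_minimaxErrorProb {c : ℝ≥0∞}
    (h : ∀ T : (Fin n → EuclideanSpace ℝ (Fin p)) → Matrix (Fin p) (Fin p) ℝ, IsEstimator T →
      ∀ s : ℝ≥0∞, (∀ S ∈ F, ∀ S', wassersteinOne (multivariateGaussian 0 S)
          (multivariateGaussian 0 S') ≤ ENNReal.ofReal ε →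
        Measure.pi (fun _ : Fin n => multivariateGaussian 0 S')
          {x | r ≤ spectralNorm₂ (S - T x)} ≤ s) → c ≤ s) :
    c ≤ minimaxErrorProb n F ε r := by
  refine le_iInf₂ fun T hT => h T hT _ fun S hS S' hW => ?_
  exact le_iSup₂_of_le S hS
    (le_iSup₂_of_le (⟨multivariateGaussian 0 S', inferInstance⟩ : ProbabilityMeasure _) hW le_rfl)

/-- The law with covariance `S'` is admissible for both truths. By the triangle inequality every
sample has error at least r for one of them, so the two error probabilities under this single law
sum to at least 1. -/
lemma minimaxErrorProb_ge_of_wassersteinOne_le {S S' : Matrix (Fin p) (Fin p) ℝ}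
    (hS : S ∈ F) (hS' : S' ∈ F)
    (hW : wassersteinOne (multivariateGaussian 0 S) (multivariateGaussian 0 S') ≤
      ENNReal.ofReal ε) (hr : 2 * r ≤ spectralNorm₂ (S - S')) :
    ENNReal.ofReal (1 / 8) ≤ minimaxErrorProb n F ε r := by
  refine le_minimaxErrorProb fun T hT s hs => ?_
  have h1 := hs S hS S' hW
  have h2 := hs S' hS' S' ((wassersteinOne_self _).trans_le zero_le)
  set P := Measure.pi (fun _ : Fin n => multivariateGaussian 0 S')
  have h3 : (1 : ℝ≥0∞) ≤ s + s := by
    refine le_trans ?_ (add_le_add h1 h2)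
    refine le_trans (le_of_eq ?_) (measure_union_le _ _)
    rw [← measure_univ (μ := P)]
    congr 1
    symm
    rw [Set.eq_univ_iff_forall]
    intro x
    by_contra hx
    simp only [Set.mem_union, Set.mem_ofPred_eq, not_or, not_le] at hx
    have := spectralNorm₂_sub_le S S' (T x)
    linarith
  by_contra hlt
  rw [not_le] at hlt
  have h4 := h3.trans (add_le_add hlt.le hlt.le)
  rw [← ENNReal.ofReal_add (by norm_num) (by norm_num), ENNReal.one_le_ofReal] at h4
  norm_num at h4

lemma minimaxErrorProb_ge_of_spikedCov (hm : 2 ≤ m) (φ : Fin d × Fin m ↪ Fin p) {a τ : ℝ}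
    (ha : 0 ≤ a) (hτ : 0 ≤ τ) (hτ1 : τ * d ≤ 1 / 2) (hn : n * (τ ^ 2 * d) ≤ Real.log m / 16)
    (hbase : a • 1 ∈ F) (hspike : ∀ f, a • spikedCov φ τ f ∈ F) (hr : 2 * r ≤ a * (τ * d)) :
    ENNReal.ofReal (1 / 8) ≤ minimaxErrorProb n F ε r := by
  refine le_minimaxErrorProb fun T hT s hs => ?_
  have hm0 : (0 : ℝ) < m := by
    have : 0 < m := by omega
    exact_mod_cast this
  set A : Set (Fin n → EuclideanSpace ℝ (Fin p)) := {x | r ≤ spectralNorm₂ (a • 1 - T x)}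
  have hA : MeasurableSet A := measurableSet_spectral_error hT _ _
  set g : (Fin n → EuclideanSpace ℝ (Fin p)) → Fin n → EuclideanSpace ℝ (Fin p) :=
    fun x i => Real.sqrt a • x i
  have hg : Measurable g := by fun_prop
  have hself : ∀ S : Matrix (Fin p) (Fin p) ℝ, wassersteinOne (multivariateGaussian 0 S)
      (multivariateGaussian 0 S) ≤ ENNReal.ofReal ε := fun S =>
    (wassersteinOne_self _).trans_le zero_le
  have h0 : Measure.pi (fun _ : Fin n => stdGaussian (EuclideanSpace ℝ (Fin p))) (g ⁻¹' A) ≤ s := by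
    have := hs _ hbase _ (hself _)
    rwa [pi_multivariateGaussian_smul ha Matrix.PosSemidef.one hA,
      multivariateGaussian_zero_one] at this
  -- Outside `A` the estimate is within r of a • 1, hence at least r away from the spiked matrix,
  -- whose distance from a • 1 is at least 2r.
  have h1 : ∀ f, (1 : ℝ≥0∞) ≤
      Measure.pi (fun _ : Fin n => multivariateGaussian 0 (spikedCov φ τ f)) (g ⁻¹' A) + s :=
    fun f => by
      rw [← pi_multivariateGaussian_smul ha (posSemidef_spikedCov φ hτ f) hA]
      refine le_trans ?_ (add_le_add le_rfl (hs _ (hspike f) _ (hself _)))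
      refine le_trans (le_of_eq ?_) (measure_union_le _ _)
      rw [← measure_univ (μ := Measure.pi
        (fun _ : Fin n => multivariateGaussian 0 (a • spikedCov φ τ f)))]
      congr 1
      symm
      rw [Set.eq_univ_iff_forall]
      intro x
      by_contra hx
      simp only [A, Set.mem_union, Set.mem_ofPred_eq, not_or, not_le] at hx
      have := spectralNorm₂_sub_le (a • spikedCov φ τ f) (a • 1) (T x)
      rw [spectralNorm₂_smul_spikedCov_sub ha hτ] at this
      linarith
  have hc : ((Fintype.card (Fin d → Fin m × Bool) : ℕ) : ℝ≥0∞) = ENNReal.ofReal ((2 * m) ^ d) := by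
    rw [← ENNReal.ofReal_natCast]
    congr 1
    simp [mul_comm]
  -- Averaged over the (2m)^d sign vectors this reads 1 ≤ 1/2 + s + s, which excludes s < 1/8.
  have h2 : ENNReal.ofReal ((2 * m) ^ d) ≤ ENNReal.ofReal ((2 * m) ^ d / 2) +
      ENNReal.ofReal ((2 * m) ^ d) * s + ENNReal.ofReal ((2 * m) ^ d) * s := by
    calc ENNReal.ofReal ((2 * m) ^ d) = ∑ _f : Fin d → Fin m × Bool, (1 : ℝ≥0∞) := by
          rw [← hc]; simp
      _ ≤ ∑ f, (Measure.pi (fun _ : Fin n => multivariateGaussian 0 (spikedCov φ τ f)) (g ⁻¹' A) +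
            s) := Finset.sum_le_sum fun f _ => h1 f
      _ ≤ _ := by
          rw [Finset.sum_add_distrib]
          refine add_le_add ((sum_pi_spikedCov_le hm φ hτ hτ1 hn (hg hA)).trans (by gcongr)) ?_
          rw [Finset.sum_const, Finset.card_univ, nsmul_eq_mul, hc]
  by_contra hlt
  rw [not_le] at hlt
  have hN : (0 : ℝ) < (2 * m) ^ d := by positivity
  have h3 : ENNReal.ofReal ((2 * m) ^ d) ≤ ENNReal.ofReal ((2 * m) ^ d / 2) +
      ENNReal.ofReal ((2 * m) ^ d) * ENNReal.ofReal (1 / 8) +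
        ENNReal.ofReal ((2 * m) ^ d) * ENNReal.ofReal (1 / 8) := h2.trans (by gcongr)
  rw [← ENNReal.ofReal_mul hN.le, ← ENNReal.ofReal_add (by positivity) (by positivity),
    ← ENNReal.ofReal_add (by positivity) (by positivity),
    ENNReal.ofReal_le_ofReal_iff (by positivity)] at h3
  linarith

/-- The class contains all rescaled spiked covariance matrices of a design with `d` groups of `m`
coordinates whose complexity `d log m` is at least of order `y`. -/
def ContainsSpikes (F : Set (Matrix (Fin p) (Fin p) ℝ)) (y : ℝ) : Prop :=
  ∃ (d m : ℕ) (φ : Fin d × Fin m ↪ Fin p), 1 ≤ d ∧ 2 ≤ m ∧ y ≤ 8 * (d * Real.log m) ∧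
    ∀ a τ : ℝ, 0 ≤ a → 0 ≤ τ → ∀ f, a • spikedCov φ τ f ∈ F

/-- The class contains the covariance matrices of all Gaussian laws on one line. -/
def ContainsLine (F : Set (Matrix (Fin p) (Fin p) ℝ)) : Prop :=
  ∃ u : EuclideanSpace ℝ (Fin p), ‖u‖ = 1 ∧
    ∀ b : ℝ, Matrix.vecMulVec (b • u).ofLp (b • u).ofLp ∈ F

lemma spectralNorm₂_line_sub {u : EuclideanSpace ℝ (Fin p)} (hu : ‖u‖ = 1) {b c : ℝ}
    (hcb : c ^ 2 ≤ b ^ 2) :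
    spectralNorm₂ (Matrix.vecMulVec (b • u).ofLp (b • u).ofLp -
      Matrix.vecMulVec (c • u).ofLp (c • u).ofLp) = b ^ 2 - c ^ 2 := by
  have h : Matrix.vecMulVec (b • u).ofLp (b • u).ofLp -
      Matrix.vecMulVec (c • u).ofLp (c • u).ofLp =
      (b ^ 2 - c ^ 2) • Matrix.vecMulVec u.ofLp u.ofLp := by
    simp only [WithLp.ofLp_smul, Matrix.smul_vecMulVec, Matrix.vecMulVec_smul, smul_smul, sq,
      sub_smul]
  rw [h, spectralNorm₂_smul (by linarith), spectralNorm₂_vecMulVec, hu]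
  ring

lemma spectralNorm₂_line {u : EuclideanSpace ℝ (Fin p)} (hu : ‖u‖ = 1) (b : ℝ) :
    spectralNorm₂ (Matrix.vecMulVec (b • u).ofLp (b • u).ofLp) = b ^ 2 := by
  rw [spectralNorm₂_vecMulVec, norm_smul, hu, mul_one, Real.norm_eq_abs, sq_abs]

lemma minimaxErrorProb_ge_of_containsLine_normBounded (hF : ContainsLine F) {M₁ M₂ : ℝ}
    (hM₁ : 0 < M₁) (hM : M₁ < M₂) (hε : 0 ≤ ε) (hε1 : ε ≤ 1)
    (hr : r ≤ Real.sqrt M₁ * min 1 (Real.sqrt M₂ - Real.sqrt M₁) * ε) :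
    ENNReal.ofReal (1 / 8) ≤ minimaxErrorProb n (normBounded F M₁ M₂) ε r := by
  obtain ⟨u, hu, hF⟩ := hF
  set b := Real.sqrt M₁
  -- The step ηε is at most ε, as the Wasserstein constraint demands, and (b + ηε)² ≤ M₂ because ε ≤
  -- 1. The squares differ by at least 2bηε.
  set η := min 1 (Real.sqrt M₂ - b)
  have hb : 0 < b := Real.sqrt_pos.2 hM₁
  have hb2 : b ^ 2 = M₁ := Real.sq_sqrt hM₁.le
  have hη : 0 ≤ η := le_min zero_le_one (sub_nonneg.2 (Real.sqrt_le_sqrt hM.le))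
  have hη1 : η ≤ 1 := min_le_left _ _
  have hη2 : b + η * ε ≤ Real.sqrt M₂ := by
    have : η ≤ Real.sqrt M₂ - b := min_le_right _ _
    nlinarith
  have hηε : 0 ≤ η * ε := by positivity
  have hlow : b ^ 2 ≤ (b + η * ε) ^ 2 := pow_le_pow_left₀ hb.le (by linarith) 2
  have hup : (b + η * ε) ^ 2 ≤ M₂ := by
    rw [← Real.sq_sqrt (hM₁.trans hM).le]
    exact pow_le_pow_left₀ (by positivity) hη2 2
  refine minimaxErrorProb_ge_of_wassersteinOne_le (S := Matrix.vecMulVec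
      ((b + η * ε) • u).ofLp ((b + η * ε) • u).ofLp)
    (S' := Matrix.vecMulVec (b • u).ofLp (b • u).ofLp) ⟨hF _, ?_⟩ ⟨hF _, ?_⟩
    ((wassersteinOne_line_le hu _ _).trans (ENNReal.ofReal_le_ofReal ?_)) ?_
  · rw [spectralNorm₂_line hu]; exact ⟨by linarith, hup⟩
  · rw [spectralNorm₂_line hu]; exact ⟨by linarith, by linarith⟩
  · rw [add_sub_cancel_left, abs_of_nonneg hηε]
    nlinarith
  · rw [spectralNorm₂_line_sub hu hlow]
    nlinarith

lemma minimaxErrorProb_ge_of_containsLine (hF : ContainsLine F) (hε : 0 ≤ ε) (hr : r ≤ ε) :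
    ENNReal.ofReal (1 / 8) ≤ minimaxErrorProb n F ε r := by
  obtain ⟨u, hu, hF⟩ := hF
  have hlow : (1 : ℝ) ^ 2 ≤ (1 + ε) ^ 2 := by nlinarith
  refine minimaxErrorProb_ge_of_wassersteinOne_le (hF (1 + ε)) (hF 1)
    ((wassersteinOne_line_le hu _ _).trans (ENNReal.ofReal_le_ofReal ?_)) ?_
  · rw [add_sub_cancel_left, abs_of_nonneg hε]
  · rw [spectralNorm₂_line_sub hu hlow]
    nlinarith

lemma minimaxErrorProb_ge_of_containsSpikes_normBounded {y A c M₁ M₂ : ℝ}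
    (hF : ContainsSpikes F y) (hM₁ : 0 < M₁) (hn : 1 ≤ n) (hy : 0 ≤ y) (hyA : y ≤ A * n)
    (hc : 0 ≤ c) (hc1 : c ≤ 1 / 12) (hcA : c * Real.sqrt A ≤ 1 / 2)
    (hcM : M₁ * (1 + c * Real.sqrt A) ≤ M₂) (hr : r ≤ M₁ * c / 2 * Real.sqrt (y / n)) :
    ENNReal.ofReal (1 / 8) ≤ minimaxErrorProb n (normBounded F M₁ M₂) ε r := by
  obtain ⟨d, m, φ, hd, hm, hym, hF⟩ := hF
  have hn0 : (0 : ℝ) < n := by exact_mod_cast hn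
  have hd0 : (0 : ℝ) < d := by exact_mod_cast hd
  set δ := c * Real.sqrt (y / n)
  have hδ : 0 ≤ δ := by positivity
  have hδA : δ ≤ c * Real.sqrt A := by
    refine mul_le_mul_of_nonneg_left (Real.sqrt_le_sqrt ?_) hc
    rwa [div_le_iff₀ hn0]
  have hδd : δ / d * d = δ := div_mul_cancel₀ _ hd0.ne'
  have hτ : 0 ≤ δ / d := by positivity
  have hmem : ∀ τ, 0 ≤ τ → τ * d ≤ δ → ∀ f, M₁ • spikedCov φ τ f ∈ normBounded F M₁ M₂ :=
    fun τ hτ0 hτd f => by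
      refine ⟨hF _ _ hM₁.le hτ0 f, le_spectralNorm₂_smul_spikedCov hM₁.le hτ0 hd φ f,
        (spectralNorm₂_smul_spikedCov_le hM₁.le hτ0 φ f).trans (le_trans ?_ hcM)⟩
      exact mul_le_mul_of_nonneg_left (by linarith) hM₁.le
  refine minimaxErrorProb_ge_of_spikedCov hm φ hM₁.le hτ (by rw [hδd]; linarith) ?_ ?_
    (hmem _ hτ hδd.le) ?_
  · have h1 : n * ((δ / d) ^ 2 * d) = c ^ 2 * y / d := by
      simp only [δ]
      rw [div_pow, mul_pow, Real.sq_sqrt (by positivity)]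
      field_simp
    rw [h1, div_le_iff₀ hd0]
    -- The bound 1/12 on c suffices because 8/144 ≤ 1/16, where 8 is the constant in
    -- `ContainsSpikes`.
    have h2 : c ^ 2 ≤ 1 / 144 := by nlinarith
    have h3 : 0 ≤ Real.log m := Real.log_natCast_nonneg m
    calc c ^ 2 * y ≤ 1 / 144 * (8 * (d * Real.log m)) := by gcongr
      _ ≤ Real.log m / 16 * d := by nlinarith [mul_nonneg hd0.le h3]
  -- The null matrix belongs to the class as the spiked matrix with τ = 0.
  · rw [← spikedCov_zero φ fun _ => (⟨0, by omega⟩, true)]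
    exact hmem 0 le_rfl (by simpa using hδ) _
  · rw [hδd]
    linarith

/-- Over a class that is stable under rescaling no error level can be guaranteed. -/
lemma minimaxErrorProb_ge_of_containsSpikes {y : ℝ} (hF : ContainsSpikes F y) (hr : 0 ≤ r) :
    ENNReal.ofReal (1 / 8) ≤ minimaxErrorProb n F ε r := by
  obtain ⟨d, m, φ, hd, hm, -, hF⟩ := hF
  have hd0 : (1 : ℝ) ≤ d := by exact_mod_cast hd
  have hL : 0 < Real.log m := Real.log_pos (by exact_mod_cast hm)
  -- This τ makes the spikes undetectable whatever r is; the scale 2r / (τ d) chosen below then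
  -- produces the separation. The n + 1 keeps the denominator positive when n = 0.
  set τ : ℝ := min (1 / (2 * d)) (Real.log m / (16 * (n + 1) * d))
  have hτ : 0 < τ := lt_min (by positivity) (by positivity)
  have hτ1 : τ * d ≤ 1 / 2 := by
    have h : τ ≤ 1 / (2 * d) := min_le_left _ _
    rw [le_div_iff₀ (by positivity)] at h
    linarith
  have hτ2 : (n + 1) * (τ * d) ≤ Real.log m / 16 := by
    have h : τ ≤ Real.log m / (16 * (n + 1) * d) := min_le_right _ _
    rw [le_div_iff₀ (by positivity)] at h
    linarith
  have ha : 0 ≤ 2 * r / (τ * d) := by positivity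
  refine minimaxErrorProb_ge_of_spikedCov hm φ ha hτ.le hτ1 ?_ ?_ (hF _ _ ha hτ.le) ?_
  · refine le_trans ?_ hτ2
    have : τ ≤ 1 := by nlinarith
    have hn : (0 : ℝ) ≤ n := n.cast_nonneg
    calc n * (τ ^ 2 * d) = n * (τ * (τ * d)) := by ring
      _ ≤ (n + 1) * (1 * (τ * d)) := by gcongr; linarith
      _ = (n + 1) * (τ * d) := by ring
  · rw [← spikedCov_zero φ fun _ => (⟨0, by omega⟩, true)]
    exact hF _ _ ha le_rfl _
  · rw [div_mul_cancel₀]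
    positivity

theorem exists_minimaxErrorProb_normBounded_ge {M₁ M₂ A : ℝ} (hM₁ : 0 < M₁) (hM : M₁ < M₂)
    (hA : 0 < A) :
    ∃ C c : ℝ, 0 < C ∧ 0 < c ∧
      ∀ (n p : ℕ) (F : Set (Matrix (Fin p) (Fin p) ℝ)) (y ε : ℝ), 1 ≤ n → 0 ≤ y → 0 ≤ ε → ε ≤ 1 →
        y ≤ A * n → ContainsLine F → (y = 0 ∨ ContainsSpikes F y) →
        ENNReal.ofReal c ≤ minimaxErrorProb n (normBounded F M₁ M₂) ε
          (C * max (Real.sqrt (y / n)) ε) := by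
  have hsA : 0 < Real.sqrt A := Real.sqrt_pos.2 hA
  have hsM : Real.sqrt M₁ < Real.sqrt M₂ := Real.sqrt_lt_sqrt hM₁.le hM
  have hM' : 0 < (M₂ - M₁) / M₁ := div_pos (by linarith) hM₁
  -- With y/n ≤ A the relative spike size is at most c√A; the inner minimum keeps it below 1/2 and
  -- keeps M₁(1 + c√A) below M₂.
  set c := min (1 / 12) (min (1 / 2) ((M₂ - M₁) / M₁) / Real.sqrt A)
  have hc : 0 < c := lt_min (by norm_num) (div_pos (lt_min (by norm_num) hM') hsA)
  have hcA : c * Real.sqrt A ≤ min (1 / 2) ((M₂ - M₁) / M₁) :=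
    (le_div_iff₀ hsA).1 (min_le_right _ _)
  set Cε := Real.sqrt M₁ * min 1 (Real.sqrt M₂ - Real.sqrt M₁)
  have hCε : 0 < Cε := mul_pos (Real.sqrt_pos.2 hM₁) (lt_min one_pos (by linarith))
  refine ⟨min (M₁ * c / 2) Cε, 1 / 8, lt_min (by positivity) hCε, by norm_num, ?_⟩
  intro n p F y ε hn hy hε hε1 hyA hline hF
  have heps : max (Real.sqrt (y / n)) ε = ε → ENNReal.ofReal (1 / 8) ≤
      minimaxErrorProb n (normBounded F M₁ M₂) ε
        (min (M₁ * c / 2) Cε * max (Real.sqrt (y / n)) ε) := fun h => by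
    refine minimaxErrorProb_ge_of_containsLine_normBounded hline hM₁ hM hε hε1 ?_
    rw [h]
    exact mul_le_mul_of_nonneg_right (min_le_right _ _) hε
  -- The case y = 0 occurs for banded matrices with k = 0 and p = 1, where no group of two
  -- coordinates exists; the maximum is then ε.
  rcases hF with rfl | hF
  · exact heps (by simpa using hε)
  rcases le_total (Real.sqrt (y / n)) ε with h | h
  · exact heps (max_eq_right h)
  · refine minimaxErrorProb_ge_of_containsSpikes_normBounded hF hM₁ hn hy hyA hc.le
      (min_le_left _ _) (hcA.trans (min_le_left _ _)) ?_ ?_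
    · have h1 := hcA.trans (min_le_right _ _)
      rw [le_div_iff₀ hM₁] at h1
      linarith
    · rw [max_eq_left h]
      exact mul_le_mul_of_nonneg_right (min_le_left _ _) (Real.sqrt_nonneg _)

theorem minimaxErrorProb_ge_of_containsLine_of_containsSpikes {y : ℝ} (hε : 0 ≤ ε)
    (hline : ContainsLine F) (hF : y = 0 ∨ ContainsSpikes F y) :
    ENNReal.ofReal (1 / 8) ≤ minimaxErrorProb n F ε (1 * max (Real.sqrt (y / n)) ε) := by
  rcases hF with rfl | hF
  · exact minimaxErrorProb_ge_of_containsLine hline hε (by simpa using hε)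
  · exact minimaxErrorProb_ge_of_containsSpikes hF (by positivity)

end Minimax


/-! ### Spikes inside the banded and sparse classes -/

section Classes

variable {p k d m : ℕ}

lemma smul_spikedCov_apply_of_ne (φ : Fin d × Fin m ↪ Fin p) (a τ : ℝ) (f : Fin d → Fin m × Bool)
    {i j : Fin p} (hij : i ≠ j) :
    (a • spikedCov φ τ f) i j = a * (τ * (signVector φ f i * signVector φ f j)) := by
  simp [spikedCov, Matrix.vecMulVec_apply, Matrix.one_apply_ne hij]

lemma posSemidef_smul_spikedCov (φ : Fin d × Fin m ↪ Fin p) {a τ : ℝ} (ha : 0 ≤ a) (hτ : 0 ≤ τ)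
    (f : Fin d → Fin m × Bool) : (a • spikedCov φ τ f).PosSemidef :=
  (posSemidef_spikedCov φ hτ f).smul ha

/-- The groups of coordinates placed one after another. -/
def consecutiveGroups (h : d * m ≤ p) : Fin d × Fin m ↪ Fin p :=
  finProdFinEquiv.toEmbedding.trans (Fin.castLEEmb h)

lemma consecutiveGroups_lt (h : d * m ≤ p) (x : Fin d × Fin m) :
    (consecutiveGroups h x : ℕ) < d * m := (finProdFinEquiv x).isLt

lemma containsLine_of_diagonal {F : Set (Matrix (Fin p) (Fin p) ℝ)} (hp : 0 < p)
    (hF : ∀ S : Matrix (Fin p) (Fin p) ℝ, S.PosSemidef → (∀ i j, i ≠ j → S i j = 0) → S ∈ F) :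
    ContainsLine F := by
  refine ⟨EuclideanSpace.single ⟨0, hp⟩ 1, by simp, fun b => hF _ (posSemidef_vecMulVec_real _) ?_⟩
  intro i j hij
  simp only [Matrix.vecMulVec_apply, WithLp.ofLp_smul, Pi.smul_apply, PiLp.single_apply, smul_eq_mul]
  split_ifs with h1 h2
  · exact absurd (h1.trans h2.symm) hij
  all_goals simp

lemma mem_bandedCov_of_diagonal {S : Matrix (Fin p) (Fin p) ℝ} (hS : S.PosSemidef)
    (h : ∀ i j, i ≠ j → S i j = 0) : S ∈ bandedCov p k := by
  refine ⟨hS, fun i j hij => h i j ?_⟩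
  rintro rfl
  simp at hij
  omega

lemma mem_sparseCov_of_diagonal {S : Matrix (Fin p) (Fin p) ℝ} (hS : S.PosSemidef)
    (h : ∀ i j, i ≠ j → S i j = 0) : S ∈ sparseCov p k := by
  refine ⟨hS, ∅, by simp, fun i j _ => ?_⟩
  rcases eq_or_ne i j with rfl | hij
  · simp
  · simp [h i j hij, Matrix.diagonal_apply_ne _ hij]

/-- The complexity is at most twice the larger of k and log p, so it is enough to realize the
dominant one. -/
lemma containsSpikes_bandedCov (hp : 2 * k < p) :
    (k : ℝ) + Real.log p = 0 ∨ ContainsSpikes (bandedCov p k) (k + Real.log p) := by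
  have hlog : 0 ≤ Real.log p := Real.log_natCast_nonneg p
  have hlog2 : 1 / 2 ≤ Real.log 2 := by linarith [Real.log_two_gt_d9]
  rcases le_or_gt (k : ℝ) (Real.log p) with h | h
  · rcases hlog.eq_or_lt with h0 | h0
    · left
      have : (0 : ℝ) ≤ k := k.cast_nonneg
      linarith
    · right
      have hp2 : 2 ≤ p := by
        by_contra hlt
        have : p = 1 := by omega
        subst this
        simp at h0
      -- With a single group the sign vector has one nonzero entry, so the spiked matrix is diagonal
      -- and any bandwidth is allowed.
      refine ⟨1, p, consecutiveGroups (by simp), le_rfl, hp2, by push_cast; linarith, ?_⟩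
      intro a τ ha hτ f
      refine mem_bandedCov_of_diagonal (posSemidef_smul_spikedCov _ ha hτ f) fun i j hij => ?_
      rw [smul_spikedCov_apply_of_ne _ _ _ _ hij]
      suffices signVector (consecutiveGroups (by simp)) f i *
          signVector (consecutiveGroups (by simp)) f j = 0 by rw [this]; simp
      by_contra hne
      obtain ⟨i', hi⟩ := exists_of_signVector_ne_zero (left_ne_zero_of_mul hne)
      obtain ⟨j', hj⟩ := exists_of_signVector_ne_zero (right_ne_zero_of_mul hne)
      exact hij (by rw [← hi, ← hj, Subsingleton.elim i' j'])
  · right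
    have hk : 0 < k := by
      have : (0 : ℝ) < k := by linarith
      exact_mod_cast this
    have hd : (k : ℝ) ≤ 2 * ((k + 1) / 2 : ℕ) := by
      have : k ≤ 2 * ((k + 1) / 2) := by omega
      exact_mod_cast this
    -- All groups lie among the first 2⌊(k+1)/2⌋ ≤ k + 1 coordinates, whose indices differ by at
    -- most k.
    refine ⟨(k + 1) / 2, 2, consecutiveGroups (by omega), by omega, le_rfl, ?_, ?_⟩
    · push_cast at hd ⊢
      nlinarith
    intro a τ ha hτ f
    refine ⟨posSemidef_smul_spikedCov _ ha hτ f, fun i j hij => ?_⟩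
    have hne : i ≠ j := by
      rintro rfl
      simp at hij
      omega
    rw [smul_spikedCov_apply_of_ne _ _ _ _ hne]
    suffices signVector (consecutiveGroups (by omega)) f i *
        signVector (consecutiveGroups (by omega)) f j = 0 by rw [this]; simp
    by_contra h0
    obtain ⟨i', hi⟩ := exists_of_signVector_ne_zero (left_ne_zero_of_mul h0)
    obtain ⟨j', hj⟩ := exists_of_signVector_ne_zero (right_ne_zero_of_mul h0)
    have hi2 := consecutiveGroups_lt (p := p) (d := (k + 1) / 2) (m := 2) (by omega) (i', (f i').1)
    have hj2 := consecutiveGroups_lt (p := p) (d := (k + 1) / 2) (m := 2) (by omega) (j', (f j').1)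
    rw [hi] at hi2
    rw [hj] at hj2
    rw [lt_abs] at hij
    omega

/-- One entry in each of k groups gives a sign vector with at most k nonzero coordinates; the
identity part is diagonal, which the class leaves free. -/
lemma containsSpikes_sparseCov (hk : 1 ≤ k) (hp : 2 * k < p) :
    ContainsSpikes (sparseCov p k) (k + k * Real.log (p / k)) := by
  have hm : 2 ≤ p / k := (Nat.le_div_iff_mul_le hk).2 hp.le
  have hk0 : (0 : ℝ) < k := by exact_mod_cast hk
  have hm' : (2 : ℝ) ≤ (p / k : ℕ) := by exact_mod_cast hm
  refine ⟨k, p / k, consecutiveGroups (Nat.mul_div_le p k), hk, hm, ?_, ?_⟩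
  -- Rounding costs a factor 2: with m = ⌊p/k⌋ ≥ 2, p/k ≤ m + 1 ≤ m². The summand k is absorbed
  -- using 1 ≤ 2 log 2 ≤ 2 log m.
  · have h1 : Real.log (p / k) ≤ 2 * Real.log (p / k : ℕ) := by
      rw [← Nat.cast_two (R := ℝ), ← Real.log_pow]
      have hp0 : (0 : ℝ) < p := by
        have : 0 < p := by omega
        exact_mod_cast this
      refine Real.log_le_log (by positivity) ?_
      rw [div_le_iff₀ hk0]
      have h2 : (p : ℝ) ≤ ((p / k : ℕ) + 1) * k := by
        rw [mul_comm]
        exact_mod_cast (Nat.lt_mul_div_succ p hk).le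
      nlinarith
    have h2 : Real.log 2 ≤ Real.log (p / k : ℕ) := Real.log_le_log (by norm_num) hm'
    have h3 := Real.log_two_gt_d9
    nlinarith
  intro a τ ha hτ f
  refine ⟨posSemidef_smul_spikedCov _ ha hτ f,
    Finset.univ.image fun i => consecutiveGroups (Nat.mul_div_le p k) (i, (f i).1),
    Finset.card_image_le.trans (by simp), fun i j hij => ?_⟩
  rcases eq_or_ne i j with rfl | hne
  · simp
  rw [Matrix.sub_apply, Matrix.diagonal_apply_ne _ hne, sub_zero,
    smul_spikedCov_apply_of_ne _ _ _ _ hne]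
  suffices signVector (consecutiveGroups (Nat.mul_div_le p k)) f i *
      signVector (consecutiveGroups (Nat.mul_div_le p k)) f j = 0 by rw [this]; simp
  by_contra h0
  have hi := exists_of_signVector_ne_zero (left_ne_zero_of_mul h0)
  have hj := exists_of_signVector_ne_zero (right_ne_zero_of_mul h0)
  simp only [Finset.mem_image, Finset.mem_univ, true_and] at hij
  tauto

end Classes

end

theorem theorem13 :
    -- banded matrices: with the bounds on the spectral norm, and over the whole class
    ((∀ M₁ M₂ A : ℝ, 0 < M₁ → M₁ < M₂ → 0 < A →
        ∃ C c : ℝ, 0 < C ∧ 0 < c ∧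
          ∀ (n p k : ℕ) (ε : ℝ), 1 ≤ n → 2 * k < p → 0 ≤ ε → ε ≤ 1 →
            (k : ℝ) + Real.log p ≤ A * n →
            ENNReal.ofReal c ≤ minimaxErrorProb n (normBounded (bandedCov p k) M₁ M₂) ε
              (C * max (Real.sqrt (((k : ℝ) + Real.log p) / n)) ε)) ∧
      (∃ C c : ℝ, 0 < C ∧ 0 < c ∧
          ∀ (n p k : ℕ) (ε : ℝ), 1 ≤ n → 2 * k < p → 0 ≤ ε →
            ENNReal.ofReal c ≤ minimaxErrorProb n (bandedCov p k) ε
              (C * max (Real.sqrt (((k : ℝ) + Real.log p) / n)) ε))) ∧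
    -- sparse matrices: with the bounds on the spectral norm, and over the whole class
    ((∀ M₁ M₂ A : ℝ, 0 < M₁ → M₁ < M₂ → 0 < A →
        ∃ C c : ℝ, 0 < C ∧ 0 < c ∧
          ∀ (n p k : ℕ) (ε : ℝ), 1 ≤ n → 1 ≤ k → 2 * k < p → 0 ≤ ε → ε ≤ 1 →
            (k : ℝ) + k * Real.log ((p : ℝ) / k) ≤ A * n →
            ENNReal.ofReal c ≤ minimaxErrorProb n (normBounded (sparseCov p k) M₁ M₂) ε
              (C * max (Real.sqrt (((k : ℝ) + k * Real.log ((p : ℝ) / k)) / n)) ε)) ∧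
      (∃ C c : ℝ, 0 < C ∧ 0 < c ∧
          ∀ (n p k : ℕ) (ε : ℝ), 1 ≤ n → 1 ≤ k → 2 * k < p → 0 ≤ ε →
            ENNReal.ofReal c ≤ minimaxErrorProb n (sparseCov p k) ε
              (C * max (Real.sqrt (((k : ℝ) + k * Real.log ((p : ℝ) / k)) / n)) ε))) := by
  refine ⟨⟨fun M₁ M₂ A hM₁ hM hA => ?_, 1, 1 / 8, one_pos, by norm_num, ?_⟩,
    fun M₁ M₂ A hM₁ hM hA => ?_, 1, 1 / 8, one_pos, by norm_num, ?_⟩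
  · obtain ⟨C, c, hC, hc, h⟩ := exists_minimaxErrorProb_normBounded_ge hM₁ hM hA
    refine ⟨C, c, hC, hc, fun n p k ε hn hp hε hε1 hy => h n p _ _ ε hn ?_ hε hε1 hy
      (containsLine_of_diagonal (by omega) fun S => mem_bandedCov_of_diagonal)
      (containsSpikes_bandedCov hp)⟩
    have := Real.log_natCast_nonneg p
    positivity
  · intro n p k ε hn hp hε
    exact minimaxErrorProb_ge_of_containsLine_of_containsSpikes hε
      (containsLine_of_diagonal (by omega) fun S => mem_bandedCov_of_diagonal)
      (containsSpikes_bandedCov hp)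
  · obtain ⟨C, c, hC, hc, h⟩ := exists_minimaxErrorProb_normBounded_ge hM₁ hM hA
    refine ⟨C, c, hC, hc, fun n p k ε hn hk hp hε hε1 hy => h n p _ _ ε hn ?_ hε hε1 hy
      (containsLine_of_diagonal (by omega) fun S => mem_sparseCov_of_diagonal)
      (Or.inr (containsSpikes_sparseCov hk hp))⟩
    have hk0 : (0 : ℝ) < k := by exact_mod_cast hk
    have hpk : (k : ℝ) ≤ p := by exact_mod_cast (by omega : k ≤ p)
    have := Real.log_nonneg ((one_le_div hk0).2 hpk)
    positivity
  · intro n p k ε hn hk hp hε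
    exact minimaxErrorProb_ge_of_containsLine_of_containsSpikes hε
      (containsLine_of_diagonal (by omega) fun S => mem_sparseCov_of_diagonal)
      (Or.inr (containsSpikes_sparseCov hk hp))
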